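/- Let $n\ge 1$, $0<q<1$, $t=q^k$ with an integer $k\ge 1$, and let $\lambda\ge 0$ be an integer. Write $(a;q)_m=\prod_{i=0}^{m-1}(1-aq^i)$, and for $y=(y_1,\dots,y_n)\in(\mathbb C^{*})^n$ put $$\Phi=x^{\lambda}\prod_{1\le j\le n}\frac{1}{(y_j/x;q)_k\,(y_j^{-1}/x;q)_k}\,\frac{dx}{x},$$ whose poles are the points $y_i^{\pm1}q^l$ with $1\le i\le n$, $0\le l<k$. Let $$E=\sum_{a_1,\dots,a_n=\pm1}\ \prod_{1\le i<j\le n}\frac{1-ty_i^{a_i}y_j^{a_j}}{1-y_i^{a_i}y_j^{a_j}}\ \prod_{1\le i\le n}\frac{1-ty_i^{2a_i}}{1-y_i^{2a_i}}\,T_{y_i}^{a_i/2},\qquad T_{y_i}^{\pm1/2}\colon y_i\mapsto q^{\pm1/2}y_i .$$ For a partition $\mu=(\mu_1\ge\cdots\ge\mu_n\ge0)$ let $m_\mu=\sum_{\nu\in W(C_n)\mu}y^\nu$ be the sum over the orbit of $\mu\in\mathbb Z^n$ under signed permutations, write $\nu<\mu$ if $\nu\neq\mu$ and $\mu-\nu$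 is a sum of positive roots $\varepsilon_i\pm\varepsilon_j$ $(i<j)$, $2\varepsilon_i$ of $C_n$, and let $c_\mu=q^{-\frac12(\mu_1+\cdots+\mu_n)}\prod_{i=1}^n(1+q^{\mu_i}t^{n-i+1})$. The Macdonald polynomial $P_\mu(y|q,t)$ of type $C_n$ is the Laurent polynomial of the form $P_\mu=m_\mu+\sum_{\nu<\mu}a_{\mu\nu}m_\nu$ (sum over partitions $\nu$) with $E P_\mu=c_\mu P_\mu$. Then the Macdonald polynomial $P_{(\lambda,0,\dots,0)}(y|q,t)$ exists and is unique, and for every $y\in(\mathbb C^*)^n$ and every positively oriented circle $C$ centred at the origin that encloses all poles of $\Phi$, $$\frac1{2\pi\sqrt{-1}}\int_C\Phi=\frac{(t;q)_\lambda}{(q;q)_\lambda}\,P_{(\lambda,0,\dots,0)}(y|q,t).$$ The same formula holds with $C$ replaced by any cycle homologous to $C$ in the complement of the poles. If $C_i^{(+)}$ and $C_i^{(-)}$ $(1\le i\le n)$ are closed paths avoiding the poles, with winding number $1$ around the poles $y_i,y_iq,\dots,y_iq^{k-1}$ (respectively $y_i^{-1},y_i^{-1}q,\dots,y_i^{-1}q^{k-1}$)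 and winding number $0$ around all the other poles, then $C$ is homologous to $\sum_{i=1}^n C_i^{(+)}+\sum_{i=1}^nC_i^{(-)}$ in the complement of the poles. -/

import Mathlib

open scoped Real

noncomputable section

/-- The finite `q`-shifted factorial `(a;q)_m = (1 - a) (1 - a q) ⋯ (1 - a q^(m-1))`. -/
def qPoch (a q : ℂ) (m : ℕ) : ℂ := ∏ i ∈ Finset.range m, (1 - a * q ^ i)

section MacdonaldC

variable {n : ℕ}

/-- Laurent polynomials in `y_1, …, y_n`: the group algebra of the weight lattice `ℤ^n` of
type `C_n`. -/
abbrev Laurent (n : ℕ) : Type := AddMonoidAlgebra ℂ (Fin n → ℤ)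

/-- The value of a Laurent polynomial at a point, where `e^ν` is `y_1^{ν_1} ⋯ y_n^{ν_n}`. -/
def Laurent.eval (P : Laurent n) (y : Fin n → ℂ) : ℂ :=
  P.coeff.sum fun ν c => c * ∏ i, y i ^ ν i

/-- The orbit `W(C_n) μ`: all images of `μ` under signed permutations. -/
def weylOrbit (μ : Fin n → ℤ) : Finset (Fin n → ℤ) :=
  Finset.univ.image fun w : (Fin n → ℤˣ) × Equiv.Perm (Fin n) =>
    fun i => (w.1 i : ℤ) * μ (w.2 i)

/-- The monomial symmetric function `m_μ`, the sum of `e^ν` over the orbit of `μ`. -/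
def orbitSum (μ : Fin n → ℤ) : Laurent n :=
  ∑ ν ∈ weylOrbit μ, AddMonoidAlgebra.single ν 1

/-- Partitions `μ_1 ≥ ⋯ ≥ μ_n ≥ 0`. -/
def IsPartition (μ : Fin n → ℤ) : Prop := Antitone μ ∧ ∀ i, 0 ≤ μ i

/-- The positive roots of type `C_n`: `ε_i - ε_j` and `ε_i + ε_j` for `i < j`, and `2 ε_i`. -/
def positiveRoots (n : ℕ) : Set (Fin n → ℤ) :=
  {α | (∃ i j, i < j ∧ (α = Pi.single i 1 - Pi.single j 1 ∨ α = Pi.single i 1 + Pi.single j 1)) ∨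
    ∃ i, α = Pi.single i 2}

/-- The positive cone `Q^+` of the root lattice. -/
def positiveCone (n : ℕ) : AddSubmonoid (Fin n → ℤ) := AddSubmonoid.closure (positiveRoots n)

/-- The strict order `ν < μ`. -/
def DominatedBy (ν μ : Fin n → ℤ) : Prop := ν ≠ μ ∧ μ - ν ∈ positiveCone n

/-- The shift `T_{y_1}^{a_1/2} ⋯ T_{y_n}^{a_n/2}` on points: `y_i` becomes `q^(a_i/2) y_i`. -/
def halfShift (q : ℝ) (a : Fin n → ℤˣ) (y : Fin n → ℂ) : Fin n → ℂ :=
  fun i => ((q ^ (((a i : ℤ) : ℝ) / 2) : ℝ) : ℂ) * y i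

/-- Macdonald's `q`-difference operator `E` of type `C_n`, acting on functions. -/
def macdonaldE (q t : ℝ) (f : (Fin n → ℂ) → ℂ) (y : Fin n → ℂ) : ℂ :=
  ∑ a : Fin n → ℤˣ,
    (∏ i, ∏ j ∈ Finset.Ioi i,
      (1 - t * (y i ^ (a i : ℤ) * y j ^ (a j : ℤ))) / (1 - y i ^ (a i : ℤ) * y j ^ (a j : ℤ))) *
    (∏ i, (1 - t * y i ^ (2 * (a i : ℤ))) / (1 - y i ^ (2 * (a i : ℤ)))) *
    f (halfShift q a y)

/-- The points of the torus at which no coefficient of `E` has a vanishing denominator. -/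
def IsRegularPoint (y : Fin n → ℂ) : Prop :=
  (∀ i, y i ≠ 0) ∧
  (∀ i j, i < j → ∀ a b : ℤˣ, 1 - y i ^ (a : ℤ) * y j ^ (b : ℤ) ≠ 0) ∧
  ∀ i, ∀ a : ℤˣ, 1 - y i ^ (2 * (a : ℤ)) ≠ 0

/-- The eigenvalue `c_μ = q^(-(μ_1 + ⋯ + μ_n)/2) ∏_{i=1}^n (1 + q^{μ_i} t^{n-i+1})`
(here `i` runs from `0` to `n - 1`). -/
def eigenvalueC (q t : ℝ) (μ : Fin n → ℤ) : ℝ :=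
  q ^ (-((∑ i, μ i : ℤ) : ℝ) / 2) * ∏ i : Fin n, (1 + q ^ μ i * t ^ (n - (i : ℕ)))

/-- `P` is a Macdonald polynomial `P_μ(y|q,t)` of type `C_n`: it has the form
`m_μ + ∑_{ν < μ} a_{μν} m_ν` (sum over partitions `ν`), and `E P = c_μ P`, as an identity of
rational functions, that is, at every point where the coefficients of `E` are defined. -/
def IsMacdonald (q t : ℝ) (μ : Fin n → ℤ) (P : Laurent n) : Prop :=
  (∃ a : (Fin n → ℤ) →₀ ℂ, (∀ ν ∈ a.support, IsPartition ν ∧ DominatedBy ν μ) ∧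
    P = orbitSum μ + a.sum fun ν c => c • orbitSum ν) ∧
  ∀ y : Fin n → ℂ, IsRegularPoint y →
    macdonaldE q t P.eval y = (eigenvalueC q t μ : ℂ) * P.eval y

/-- The partition `(lam, 0, …, 0)`. -/
def rowPartition (n lam : ℕ) : Fin n → ℤ := fun i => if (i : ℕ) = 0 then (lam : ℤ) else 0

end MacdonaldC

section Cycles

/-- A closed piecewise `C^1` path in the complex plane. -/
structure ClosedPath where
  /-- left end of the parameter interval -/
  a : ℝ
  /-- right end of the parameter interval -/
  b : ℝ
  a_lt_b : a < b
  /-- the parametrization (only its values on `[a, b]` matter) -/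
  toFun : ℝ → ℂ
  closed : toFun a = toFun b
  piecewise : ∃ (m : ℕ) (p : Fin (m + 1) → ℝ), StrictMono p ∧ p 0 = a ∧ p (Fin.last m) = b ∧
    ∀ i : Fin m, ContDiffOn ℝ 1 toFun (Set.Icc (p i.castSucc) (p i.succ))

/-- The contour integral `∫_γ f(x) dx`. -/
def ClosedPath.integral (γ : ClosedPath) (f : ℂ → ℂ) : ℂ :=
  ∫ s in γ.a..γ.b, deriv γ.toFun s * f (γ.toFun s)

/-- The trace of a path. -/
def ClosedPath.trace (γ : ClosedPath) : Set ℂ := γ.toFun '' Set.Icc γ.a γ.b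

/-- The circle around the origin of radius `R`, traversed once counterclockwise. -/
def circlePath (R : ℝ) : ClosedPath where
  a := 0
  b := 2 * π
  a_lt_b := Real.two_pi_pos
  toFun := circleMap 0 R
  closed := by simp [circleMap]
  piecewise := ⟨1, ![0, 2 * π], by
      intro i j hij
      fin_cases i <;> fin_cases j <;> simp_all [Real.pi_pos], by simp, by simp [Fin.last],
    fun _ => (contDiff_circleMap 0 R).contDiffOn⟩

/-- Cycles: formal finite integer combinations of closed paths. -/
abbrev Cycle1 : Type := ClosedPath →₀ ℤ

/-- A closed path as a cycle. -/
def ClosedPath.toCycle (γ : ClosedPath) : Cycle1 := Finsupp.single γ 1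

/-- The integral `∫_Γ f(x) dx` over a cycle. -/
def cycleIntegral (Γ : Cycle1) (f : ℂ → ℂ) : ℂ := Γ.sum fun γ m => (m : ℂ) * γ.integral f

/-- The winding number of a cycle around `p`. -/
def windingNumber (Γ : Cycle1) (p : ℂ) : ℂ :=
  (2 * π * Complex.I)⁻¹ * cycleIntegral Γ fun x => (x - p)⁻¹

/-- The cycle lies in `U`. -/
def Cycle1.LiesIn (Γ : Cycle1) (U : Set ℂ) : Prop := ∀ γ ∈ Γ.support, γ.trace ⊆ U

/-- Homology of cycles in the plane region `U`: both cycles lie in `U` and wind equally often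
around every point outside `U`. -/
def Homologous (U : Set ℂ) (Γ Γ' : Cycle1) : Prop :=
  Γ.LiesIn U ∧ Γ'.LiesIn U ∧ ∀ p, p ∉ U → windingNumber Γ p = windingNumber Γ' p

end Cycles

section Integrand

variable {n : ℕ}

/-- The coefficient of `dx` in the 1-form
`Φ = x^lam ∏_j 1 / ((y_j/x;q)_k (y_j⁻¹/x;q)_k) dx/x`. -/
def phi (q : ℝ) (k lam : ℕ) (y : Fin n → ℂ) (x : ℂ) : ℂ :=
  x ^ lam * (∏ j, 1 / (qPoch (y j / x) q k * qPoch ((y j)⁻¹ / x) q k)) / x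

/-- The pole `y_i^s q^l` of `Φ`, for `s = ±1` and `0 ≤ l < k`. -/
def pole (q : ℝ) (y : Fin n → ℂ) (i : Fin n) (s : ℤˣ) (l : ℕ) : ℂ :=
  y i ^ (s : ℤ) * (q : ℂ) ^ l

/-- The set of all poles of `Φ`. -/
def poles (q : ℝ) (k : ℕ) (y : Fin n → ℂ) : Set ℂ :=
  {p | ∃ i, ∃ s : ℤˣ, ∃ l < k, p = pole q y i s l}

/-- The closed path `γ` can be taken as `C_i^(s)`: it avoids all poles, winds once
counterclockwise around the poles `y_i^s q^l`, and has all the other poles outside. -/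
def IsolatesFamily (q : ℝ) (k : ℕ) (y : Fin n → ℂ) (i : Fin n) (s : ℤˣ) (γ : ClosedPath) :
    Prop :=
  γ.trace ⊆ (poles q k y)ᶜ ∧
  ∀ j, ∀ r : ℤˣ, ∀ l < k,
    windingNumber γ.toCycle (pole q y j r l) = if j = i ∧ r = s then 1 else 0

end Integrand

end

/-! By the `q`-binomial theorem, 1/(X;q)_k = Σ (t;q)_m/(q;q)_m X^m. Let g_m (`rowLaurent`) be the
coefficient of X^m in G(X) = ∏_j 1/((y_j X;q)_k (y_j⁻¹X;q)_k). With X = 1/x, the circle integral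
reads off g_λ. So the claim is that g_λ, divided by the coefficient (t;q)_λ/(q;q)_λ of its monomial
y_1^λ, is the Macdonald polynomial of the row.

Eigenfunction: a half shift with signs a, followed by X ↦ q^{1/2}X, sends y_j^{a_j}X to q y_j^{a_j}X
and fixes y_j^{-a_j}X, so it multiplies G by a rational function of X. Clearing denominators turns
the eigenvalue equations of all g_m at once into one polynomial identity in X,
`sum_shiftCoeff_mul_prod`. That identity holds by interpolation: at suitable nodes half of the sign
vectors drop out, and the others reduce to the sum of the coefficients of `E` in one variable fewer,
a constant by induction (`sum_shiftCoeff`).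

Triangularity: g_m is invariant under signed permutations, its exponents have size at most m, and
their coordinate sums have the parity of m. All partitions of this kind except the row itself lie
below the row (`dominatedBy_rowPartition`).

Uniqueness: a nonzero difference of two candidates is an eigenfunction. Letting y tend to infinity
in a generic dominant direction shows that its eigenvalue is c_κ for one of its own exponents κ
(`exists_eigenvalueC_eq`), while the eigenvalue of the row is strictly larger than each such c_κ
(`eigenvalueC_lt_rowPartition`).

Contours: the circle integral obeys the same recursion in the poles as the series coefficients
(`circleCoeff_eq_coeff`), so coincident poles need no separate treatment. For a homologous cycle, Φ
is split into partial fractions. All terms but the simple fractions 1/(x - p) have primitives, and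
those integrate to winding numbers. -/

noncomputable section

/-! ### Interpolation and products over pairs -/

open Polynomial in
/-- A polynomial of degree at most `2 card ι` that vanishes at the points `(c i)⁻¹`, and whose
leading coefficient is `s` times its constant term with `s` different from the product of the
`c i`, is zero. -/
theorem Polynomial.eq_zero_of_eval_inv_of_coeff {ι : Type*} [Fintype ι] (D : ℂ[X]) (c : ι → ℂ)
    (hc : ∀ i, c i ≠ 0) (hinj : Function.Injective c) (hdeg : D.natDegree ≤ Fintype.card ι)
    (hD : ∀ i, D.eval (c i)⁻¹ = 0) (s : ℂ) (hs : (-1) ^ Fintype.card ι * ∏ i, c i ≠ s)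
    (hlead : D.coeff (Fintype.card ι) = s * D.coeff 0) : D = 0 := by
  classical
  set Q : ℂ[X] := ∏ i, (C (-c i) * X + C 1) with hQ
  have hQd : Q.natDegree ≤ Fintype.card ι := by
    refine (natDegree_prod_le _ _).trans ?_
    refine (Finset.sum_le_card_nsmul _ _ 1 fun i _ => natDegree_linear_le).trans ?_
    simp
  have hQ0 : Q.eval 0 = 1 := by simp [hQ, eval_prod]
  have hQi : ∀ i, Q.eval (c i)⁻¹ = 0 := by
    intro i
    rw [hQ, eval_prod]
    refine Finset.prod_eq_zero (Finset.mem_univ i) ?_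
    simp [hc i]
  have hQl : Q.coeff (Fintype.card ι) = (-1) ^ Fintype.card ι * ∏ i, c i := by
    have h := coeff_prod_of_natDegree_le (s := Finset.univ) (fun i => C (-c i) * X + C 1) 1
      (fun i _ => natDegree_linear_le)
    rw [Finset.card_univ, mul_one] at h
    rw [hQ, h]
    simp [coeff_one, Finset.prod_neg]
  -- Subtracting D(0) Q adds the origin, encoded as `none`, to the zeros: one more zero than the
  -- degree bound allows.
  have key : D - C (D.coeff 0) * Q = 0 := by
    refine eq_zero_of_natDegree_lt_card_of_eval_eq_zero (ι := Option ι) _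
      (f := fun o => o.elim 0 fun i => (c i)⁻¹) ?_ ?_ ?_
    · rintro (_ | i) (_ | j) h
      · rfl
      · exact absurd h.symm (inv_ne_zero (hc j))
      · exact absurd h (inv_ne_zero (hc i))
      · exact congrArg some (hinj (inv_injective h))
    · rintro (_ | i)
      · simp [hQ0, coeff_zero_eq_eval_zero]
      · simp [hQi, hD]
    · rw [Fintype.card_option]
      refine Nat.lt_succ_of_le ((natDegree_sub_le _ _).trans (max_le hdeg ?_))
      exact (natDegree_C_mul_le _ _).trans hQd
  -- Now D = D(0) Q, and the top coefficients of the two sides are s D(0) and (-1)^card ∏ c_i D(0).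
  have h0 : D.coeff 0 = 0 := by
    have h := congrArg (fun p => p.coeff (Fintype.card ι)) key
    simp only [coeff_sub, coeff_C_mul, hQl, hlead, coeff_zero] at h
    by_contra h0
    exact hs (mul_left_cancel₀ h0 (by linear_combination -h))
  simpa [h0] using key

/-- Products over pairs `i < j`, with the pairs containing a given index split off. -/
theorem Fin.prod_pairs_succAbove {M : Type*} [CommMonoid M] {n : ℕ} (f : Fin (n + 1) → Fin (n + 1) → M)
    (hf : ∀ i j, f i j = f j i) (p : Fin (n + 1)) :
    ∏ i, ∏ j ∈ Finset.Ioi i, f i j =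
      (∏ j, f p (p.succAbove j)) *
        ∏ i, ∏ j ∈ Finset.Ioi i, f (p.succAbove i) (p.succAbove j) := by
  have h (m : ℕ) (g : Fin m → M) (i : Fin m) :
      ∏ j ∈ Finset.Ioi i, g j = ∏ j, if i < j then g j else 1 := by
    rw [← Finset.prod_filter]
    congr 1
    ext j
    simp
  simp only [h, Fin.prod_univ_succAbove _ p, lt_irrefl, if_false, one_mul, Finset.prod_mul_distrib,
    Fin.succAbove_lt_succAbove_iff]
  rw [← mul_assoc, ← Finset.prod_mul_distrib]
  congr 1
  refine Finset.prod_congr rfl fun j _ => ?_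
  rcases lt_or_gt_of_ne (Fin.succAbove_ne p j) with hlt | hlt
  · rw [if_neg hlt.not_gt, if_pos hlt, one_mul, hf]
  · rw [if_pos hlt, if_neg hlt.not_gt, mul_one]

/-! ### The sum over signs: Macdonald's polynomial identity -/

section Identity

variable {n : ℕ}

/-- The coefficient of the translation in `E` attached to signs `a`, as a function of
`z = y^a`. -/
def shiftCoeff (t : ℂ) (z : Fin n → ℂ) : ℂ :=
  (∏ i, ∏ j ∈ Finset.Ioi i, (1 - t * (z i * z j)) / (1 - z i * z j)) *
    ∏ i, (1 - t * z i ^ 2) / (1 - z i ^ 2)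

/-- The point `y^a = (y_1^{a_1}, …, y_n^{a_n})`. -/
def signPow (y : Fin n → ℂ) (a : Fin n → ℤˣ) (i : Fin n) : ℂ := y i ^ (a i : ℤ)

theorem shiftCoeff_succAbove (t : ℂ) (z : Fin (n + 1) → ℂ) (p : Fin (n + 1)) :
    shiftCoeff t z = (∏ j, (1 - t * (z p * z (p.succAbove j))) / (1 - z p * z (p.succAbove j))) *
      ((1 - t * z p ^ 2) / (1 - z p ^ 2)) * shiftCoeff t fun j => z (p.succAbove j) := by
  unfold shiftCoeff
  rw [Fin.prod_pairs_succAbove _ (fun i j => by rw [mul_comm (z i)]) p,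
    Fin.prod_univ_succAbove _ p]
  ring

theorem IsRegularPoint.succAbove {y : Fin (n + 1) → ℂ} (hy : IsRegularPoint y) (p : Fin (n + 1)) :
    IsRegularPoint fun j => y (p.succAbove j) :=
  ⟨fun _ => hy.1 _, fun _ _ hij => hy.2.1 _ _ (Fin.succAbove_lt_succAbove_iff.2 hij),
    fun _ => hy.2.2 _⟩

theorem IsRegularPoint.one_sub_ne_zero {y : Fin n → ℂ} (hy : IsRegularPoint y) {i j : Fin n}
    (hij : i ≠ j) (a b : ℤˣ) : 1 - y i ^ (a : ℤ) * y j ^ (b : ℤ) ≠ 0 := by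
  rcases lt_or_gt_of_ne hij with h | h
  · exact hy.2.1 i j h a b
  · rw [mul_comm]
    exact hy.2.1 j i h b a

theorem zpow_units_neg (x : ℂ) (a : ℤˣ) : x ^ ((-a : ℤˣ) : ℤ) = (x ^ (a : ℤ))⁻¹ := by
  rw [Units.val_neg, zpow_neg]

/-- A coincidence y_i^a = y_j^b makes 1 - y_i^a y_j^{-b} vanish, which is one of the excluded
denominators; for i = j it is the long-root one. This makes the interpolation nodes distinct. -/
theorem IsRegularPoint.zpow_injective {y : Fin n → ℂ} (hy : IsRegularPoint y) :
    Function.Injective fun p : Fin n × ℤˣ => y p.1 ^ (p.2 : ℤ) := by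
  rintro ⟨i, a⟩ ⟨j, b⟩ h
  simp only at h
  have hj : y j ^ (b : ℤ) ≠ 0 := zpow_ne_zero _ (hy.1 j)
  have h1 : 1 - y i ^ (a : ℤ) * y j ^ ((-b : ℤˣ) : ℤ) = 0 := by
    rw [zpow_units_neg, h, mul_inv_cancel₀ hj, sub_self]
  by_cases hij : i = j
  · subst hij
    by_cases hab : a = b
    · rw [hab]
    · have : -b = a := (by decide : ∀ a b : ℤˣ, a ≠ b → -b = a) a b hab
      rw [this, ← zpow_add₀ (hy.1 i), ← two_mul] at h1
      exact absurd h1 (hy.2.2 i a)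
  · exact absurd h1 (hy.one_sub_ne_zero hij _ _)

theorem prod_units_int {M : Type*} [CommMonoid M] (f : ℤˣ → M) : ∏ s, f s = f 1 * f (-1) := by
  rw [show (Finset.univ : Finset ℤˣ) = {1, -1} from rfl, Finset.prod_pair (by decide)]

theorem signPow_insertNth (y : Fin (n + 1) → ℂ) (p : Fin (n + 1)) (s : ℤˣ) (a : Fin n → ℤˣ) (j : Fin n) :
    signPow y (p.insertNth s a) (p.succAbove j) = signPow (fun j => y (p.succAbove j)) a j := by
  simp [signPow]

/-- The sum over sign vectors, with one sign split off. -/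
theorem sum_insertNth_signs {M : Type*} [AddCommMonoid M] (f : (Fin (n + 1) → ℤˣ) → M) (p : Fin (n + 1)) (s : ℤˣ) :
    ∑ a, f a = (∑ a : Fin n → ℤˣ, f (p.insertNth s a)) + ∑ a : Fin n → ℤˣ, f (p.insertNth (-s) a) := by
  rw [← (Fin.insertNthEquiv (fun _ => ℤˣ) p).sum_comp, Fintype.sum_prod_type]
  have : (Finset.univ : Finset ℤˣ) = {s, -s} :=
    (by decide : ∀ s : ℤˣ, (Finset.univ : Finset ℤˣ) = {s, -s}) s
  rw [this, Finset.sum_pair]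
  · rfl
  · rcases Int.units_eq_one_or s with rfl | rfl <;> decide

/-- At the node w = (tz)⁻¹ the factor 1 - t w v⁻¹ equals -(1 - zv)/(zv) and cancels the denominator,
while the remaining 1 - tzv is a multiple of 1 - w v⁻¹. What is left is symmetric in v and v⁻¹,
hence independent of the sign carried by v. -/
theorem signPow_factor_mul {t z v : ℂ} (ht : t ≠ 0) (hz : z ≠ 0) (hv : v ≠ 0)
    (h : 1 - z * v ≠ 0) :
    (1 - t * (z * v)) / (1 - z * v) * ((1 - (t * z)⁻¹ * v) * (1 - t * (t * z)⁻¹ * v⁻¹))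
      = t * ((1 - (t * z)⁻¹ * v) * (1 - (t * z)⁻¹ * v⁻¹)) := by
  field_simp
  ring

/-- Removes the signs from every expression that is symmetric in a variable and its inverse. -/
theorem zpow_units_symm {M : Type*} (f : ℂ → ℂ → M) (hf : ∀ u v, f u v = f v u) (x : ℂ) (a : ℤˣ) :
    f (x ^ (a : ℤ)) (x ^ (a : ℤ))⁻¹ = f x x⁻¹ := by
  rcases Int.units_eq_one_or a with rfl | rfl
  · simp
  · simp [hf x⁻¹ x]

/-- The summand of the `a`-sum at the point `w = (t y_p^s)⁻¹`. -/
theorem shiftCoeff_mul_prod_eval {t : ℂ} (ht : t ≠ 0) {y : Fin (n + 1) → ℂ} (hy : IsRegularPoint y)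
    (p : Fin (n + 1)) (s : ℤˣ) (a : Fin n → ℤˣ) :
    shiftCoeff t (signPow y (p.insertNth s a)) *
      ∏ j, (1 - (t * y p ^ (s : ℤ))⁻¹ * signPow y (p.insertNth s a) j) *
        (1 - t * (t * y p ^ (s : ℤ))⁻¹ * (signPow y (p.insertNth s a) j)⁻¹) =
    shiftCoeff t (signPow (fun j => y (p.succAbove j)) a) *
      (t ^ (n + 1) * ∏ j, (1 - (t * y p ^ (s : ℤ))⁻¹ * y j) * (1 - (t * y p ^ (s : ℤ))⁻¹ * (y j)⁻¹)) := by
  set z := y p ^ (s : ℤ) with hz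
  have hz0 : z ≠ 0 := zpow_ne_zero _ (hy.1 p)
  have hz2 : 1 - z ^ 2 ≠ 0 := by
    have := hy.2.2 p s
    rwa [mul_comm, zpow_mul, ← hz, zpow_ofNat] at this
  have hp : signPow y (p.insertNth s a) p = z := by simp [signPow, hz]
  have hsymm : (1 - (t * z)⁻¹ * y p) * (1 - (t * z)⁻¹ * (y p)⁻¹)
      = (1 - (t * z)⁻¹ * z) * (1 - (t * z)⁻¹ * z⁻¹) :=
    (zpow_units_symm (fun u v => (1 - (t * z)⁻¹ * u) * (1 - (t * z)⁻¹ * v))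
      (fun u v => mul_comm _ _) (y p) s).symm
  rw [shiftCoeff_succAbove t _ p, Fin.prod_univ_succAbove _ p, Fin.prod_univ_succAbove _ p, hsymm]
  simp only [hp, signPow_insertNth]
  set y' := fun j => y (p.succAbove j) with hy'
  have hj : ∀ j, (1 - t * (z * signPow y' a j)) / (1 - z * signPow y' a j) *
      ((1 - (t * z)⁻¹ * signPow y' a j) * (1 - t * (t * z)⁻¹ * (signPow y' a j)⁻¹))
      = t * ((1 - (t * z)⁻¹ * y' j) * (1 - (t * z)⁻¹ * (y' j)⁻¹)) := by
    intro j
    have hv0 : signPow y' a j ≠ 0 := zpow_ne_zero _ (hy.1 _)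
    rw [signPow_factor_mul ht hz0 hv0 (hy.one_sub_ne_zero (Fin.succAbove_ne p j).symm s (a j))]
    congr 1
    exact zpow_units_symm (fun u v => (1 - (t * z)⁻¹ * u) * (1 - (t * z)⁻¹ * v))
      (fun u v => mul_comm _ _) (y' j) (a j)
  have hprod : (∏ j, (1 - t * (z * signPow y' a j)) / (1 - z * signPow y' a j)) *
      ∏ j, (1 - (t * z)⁻¹ * signPow y' a j) * (1 - t * (t * z)⁻¹ * (signPow y' a j)⁻¹)
      = t ^ n * ∏ j, (1 - (t * z)⁻¹ * y' j) * (1 - (t * z)⁻¹ * (y' j)⁻¹) := by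
    rw [← Finset.prod_mul_distrib, Finset.prod_congr rfl fun j _ => hj j, Finset.prod_mul_distrib]
    simp
  have hlast : (1 - t * z ^ 2) / (1 - z ^ 2) * ((1 - (t * z)⁻¹ * z) * (1 - t * (t * z)⁻¹ * z⁻¹))
      = t * ((1 - (t * z)⁻¹ * z) * (1 - (t * z)⁻¹ * z⁻¹)) := by
    field_simp
    ring
  calc _ = ((∏ j, (1 - t * (z * signPow y' a j)) / (1 - z * signPow y' a j)) *
      ∏ j, (1 - (t * z)⁻¹ * signPow y' a j) * (1 - t * (t * z)⁻¹ * (signPow y' a j)⁻¹)) *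
      ((1 - t * z ^ 2) / (1 - z ^ 2) * ((1 - (t * z)⁻¹ * z) * (1 - t * (t * z)⁻¹ * z⁻¹))) *
      shiftCoeff t (signPow y' a) := by ring
    _ = _ := by rw [hprod, hlast]; ring

open Polynomial

theorem natDegree_prod_pair_le (f g : Fin n → ℂ) :
    (∏ j, (1 - C (f j) * X) * (1 - C (g j) * X) : ℂ[X]).natDegree ≤ 2 * n := by
  refine (natDegree_prod_le _ _).trans ((Finset.sum_le_card_nsmul _ _ 2 fun i _ => ?_).trans
    (by simp [mul_comm]))
  compute_degree

theorem coeff_prod_pair (f g : Fin n → ℂ) :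
    (∏ j, (1 - C (f j) * X) * (1 - C (g j) * X) : ℂ[X]).coeff (2 * n) = ∏ j, f j * g j := by
  have h := coeff_prod_of_natDegree_le (s := Finset.univ)
    (fun j => ((1 - C (f j) * X) * (1 - C (g j) * X) : ℂ[X])) 2 (fun i _ => by compute_degree)
  rw [Finset.card_univ, Fintype.card_fin, mul_comm] at h
  rw [h]
  refine Finset.prod_congr rfl fun j _ => ?_
  have : ((1 - C (f j) * X) * (1 - C (g j) * X) : ℂ[X])
      = C (f j * g j) * X ^ 2 + (- C (f j + g j) * X + 1) := by
    simp only [C_mul, C_add]; ring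
  rw [this, coeff_add, coeff_C_mul_X_pow]
  simp [coeff_one]

/-- Both sides have degree at most 2(n+1) and agree at the 2(n+1) nodes (t y_p^s)⁻¹: vectors with
a_p = -s contribute zero, and those with a_p = s leave a common factor times the sum in `hc`. One
more condition is needed: on both sides the coefficient of X^{2(n+1)} is t^{n+1} times the constant
term. A multiple of the polynomial with these nodes as roots would have ratio t^{2(n+1)}, which
differs by `htn`. -/
theorem sum_shiftCoeff_mul_prod_of_sum (t : ℂ) (ht : t ≠ 0) (htn : t ^ (n + 1) ≠ 1)
    (y : Fin (n + 1) → ℂ) (hy : IsRegularPoint y) (c : ℂ)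
    (hc : ∀ p : Fin (n + 1), ∑ a, shiftCoeff t (signPow (fun j => y (p.succAbove j)) a) = c) :
    ∑ a, C (shiftCoeff t (signPow y a)) *
        ∏ j, (1 - C (signPow y a j) * X) * (1 - C (t * (signPow y a j)⁻¹) * X) =
      C c * (∏ j, (1 - C (t * y j) * X) * (1 - C (t * (y j)⁻¹) * X) +
        C (t ^ (n + 1)) * ∏ j, (1 - C (y j) * X) * (1 - C (y j)⁻¹ * X)) := by
  have hcard : Fintype.card (Fin (n + 1) × ℤˣ) = 2 * (n + 1) := by
    simp [mul_comm]
  have hsp : ∀ a j, signPow y a j ≠ 0 := fun a j => zpow_ne_zero _ (hy.1 _)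
  rw [← sub_eq_zero]
  refine Polynomial.eq_zero_of_eval_inv_of_coeff (ι := Fin (n + 1) × ℤˣ) _
    (fun p => t * y p.1 ^ (p.2 : ℤ)) (fun p => mul_ne_zero ht (zpow_ne_zero _ (hy.1 _)))
    (fun p p' h => hy.zpow_injective (mul_left_cancel₀ ht h)) ?_ ?_ (t ^ (n + 1)) ?_ ?_
  · rw [hcard]
    refine (natDegree_sub_le _ _).trans (max_le ?_ ?_)
    · refine natDegree_sum_le_of_forall_le _ _ fun a _ => ?_
      exact (natDegree_C_mul_le _ _).trans (natDegree_prod_pair_le _ _)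
    · refine (natDegree_C_mul_le _ _).trans (natDegree_add_le_of_degree_le
        (natDegree_prod_pair_le _ _) ((natDegree_C_mul_le _ _).trans (natDegree_prod_pair_le _ _)))
  · rintro ⟨p, s⟩
    have hz0 : y p ^ (s : ℤ) ≠ 0 := zpow_ne_zero _ (hy.1 p)
    have h0 : (∏ j, (1 - t * y j * (t * y p ^ (s : ℤ))⁻¹) *
        (1 - t * (y j)⁻¹ * (t * y p ^ (s : ℤ))⁻¹)) = 0 := by
      refine Finset.prod_eq_zero (Finset.mem_univ p) ?_
      have := zpow_units_symm (fun u v => (1 - t * u * (t * y p ^ (s : ℤ))⁻¹) *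
        (1 - t * v * (t * y p ^ (s : ℤ))⁻¹)) (fun u v => mul_comm _ _) (y p) s
      rw [← this, mul_inv_cancel₀ (mul_ne_zero ht hz0)]
      simp
    have h1 : ∀ a : Fin n → ℤˣ, (∏ j, (1 - signPow y (p.insertNth (-s) a) j * (t * y p ^ (s : ℤ))⁻¹) *
        (1 - t * (signPow y (p.insertNth (-s) a) j)⁻¹ * (t * y p ^ (s : ℤ))⁻¹)) = 0 := by
      intro a
      refine Finset.prod_eq_zero (Finset.mem_univ p) ?_
      have : signPow y (p.insertNth (-s) a) p = (y p ^ (s : ℤ))⁻¹ := by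
        simp [signPow]
      rw [this, inv_inv, mul_inv_cancel₀ (mul_ne_zero ht hz0)]
      simp
    simp only [eval_sub, eval_finsetSum, eval_mul, eval_C, eval_prod, eval_one, eval_X, eval_add, h0,
      zero_add]
    rw [sum_insertNth_signs _ p s]
    simp only [h1, mul_zero, Finset.sum_const_zero, add_zero]
    have h2 := fun a => shiftCoeff_mul_prod_eval ht hy p s a
    have e1 : ∀ u : ℂ, t * (t * y p ^ (s : ℤ))⁻¹ * u = t * u * (t * y p ^ (s : ℤ))⁻¹ := fun u => by ring
    have e2 : ∀ u : ℂ, (t * y p ^ (s : ℤ))⁻¹ * u = u * (t * y p ^ (s : ℤ))⁻¹ := fun u => by ring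
    simp only [e1] at h2
    simp only [e2] at h2
    rw [Finset.sum_congr rfl fun a _ => h2 a, ← Finset.sum_mul, hc, sub_self]
  · rw [hcard, Fintype.prod_prod_type]
    simp only [prod_units_int]
    have : ∀ i, t * y i ^ ((1 : ℤˣ) : ℤ) * (t * y i ^ ((-1 : ℤˣ) : ℤ)) = t ^ 2 := by
      intro i
      have := hy.1 i
      simp
      field_simp
    simp only [this]
    intro h
    rw [Finset.prod_const, Finset.card_univ, Fintype.card_fin, (even_two_mul _).neg_one_pow,
      one_mul, ← pow_mul, mul_comm, pow_mul, pow_two] at h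
    exact htn (mul_right_cancel₀ (pow_ne_zero _ ht) (h.trans (one_mul _).symm))
  · rw [hcard]
    simp only [coeff_sub, finsetSum_coeff, coeff_C_mul, coeff_add, coeff_prod_pair]
    have h1 : ∀ a, ∏ j, signPow y a j * (t * (signPow y a j)⁻¹) = t ^ (n + 1) := by
      intro a
      rw [Finset.prod_congr rfl fun j _ => (show _ = t by have := hsp a j; field_simp)]
      simp
    have h2 : ∏ j, t * y j * (t * (y j)⁻¹) = t ^ (n + 1) * t ^ (n + 1) := by
      rw [Finset.prod_congr rfl fun j _ => (show _ = t * t by have := hy.1 j; field_simp)]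
      simp [mul_pow]
    have h3 : ∏ j, y j * (y j)⁻¹ = 1 := Finset.prod_eq_one fun j _ => mul_inv_cancel₀ (hy.1 j)
    simp only [h1, h2, h3, coeff_zero_eq_eval_zero, eval_prod, eval_mul, eval_sub, eval_one, eval_C,
      eval_X, mul_zero, sub_zero, mul_one, Finset.prod_const_one, ← Finset.sum_mul]
    ring

/-- The constant term of `E`: the sum of its coefficients. -/
theorem sum_shiftCoeff (t : ℂ) (ht : t ≠ 0) (htn : ∀ m : ℕ, t ^ (m + 1) ≠ 1) (y : Fin n → ℂ)
    (hy : IsRegularPoint y) :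
    ∑ a, shiftCoeff t (signPow y a) = ∏ i ∈ Finset.range n, (1 + t ^ (i + 1)) := by
  induction n with
  | zero => simp [shiftCoeff]
  | succ n ih =>
    -- The constant term in X of the identity is the inductive step: the bracket on the right
    -- becomes 1 + t^{n+1}.
    have h := congrArg (Polynomial.eval 0) (sum_shiftCoeff_mul_prod_of_sum t ht (htn n) y hy _
      fun p => ih _ (hy.succAbove p))
    simp only [eval_finsetSum, eval_mul, eval_C, eval_prod, eval_sub, eval_one, eval_X, eval_add,
      mul_zero, sub_zero, mul_one, Finset.prod_const_one] at h
    rw [h, Finset.prod_range_succ]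

/-- Macdonald's identity: the action of `E` on the generating function of the row polynomials. -/
theorem sum_shiftCoeff_mul_prod (t : ℂ) (ht : t ≠ 0) (htn : ∀ m : ℕ, t ^ (m + 1) ≠ 1)
    (y : Fin (n + 1) → ℂ) (hy : IsRegularPoint y) :
    ∑ a, C (shiftCoeff t (signPow y a)) *
        ∏ j, (1 - C (signPow y a j) * X) * (1 - C (t * (signPow y a j)⁻¹) * X) =
      C (∏ i ∈ Finset.range n, (1 + t ^ (i + 1))) *
        (∏ j, (1 - C (t * y j) * X) * (1 - C (t * (y j)⁻¹) * X) +
        C (t ^ (n + 1)) * ∏ j, (1 - C (y j) * X) * (1 - C (y j)⁻¹ * X)) :=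
  sum_shiftCoeff_mul_prod_of_sum t ht (htn n) y hy _ fun p =>
    sum_shiftCoeff t ht htn _ (hy.succAbove p)

end Identity

end

/-! ### The `q`-binomial series and its `q`-shift -/

noncomputable section

open PowerSeries

theorem qPoch_succ (a q : ℂ) (m : ℕ) : qPoch a q (m + 1) = qPoch a q m * (1 - a * q ^ m) :=
  Finset.prod_range_succ _ _

theorem qPoch_succ' (a q : ℂ) (m : ℕ) : qPoch a q (m + 1) = (1 - a) * qPoch (a * q) q m := by
  rw [qPoch, Finset.prod_range_succ', mul_comm]
  simp [qPoch, pow_succ', mul_assoc]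

theorem qPoch_self_ne_zero {q : ℂ} (hq : ∀ m : ℕ, q ^ (m + 1) ≠ 1) (m : ℕ) : qPoch q q m ≠ 0 := by
  refine Finset.prod_ne_zero_iff.2 fun i _ => ?_
  rw [← pow_succ']
  exact sub_ne_zero.2 (hq i).symm

/-- The power series `1 / (X; q)_k`, by the `q`-binomial theorem. -/
def qBinomSeries (q : ℂ) (k : ℕ) : ℂ⟦X⟧ := PowerSeries.mk fun m => qPoch (q ^ k) q m / qPoch q q m

theorem qBinomSeries_zero (q : ℂ) : qBinomSeries q 0 = 1 := by
  ext m
  rw [qBinomSeries, coeff_mk, coeff_one]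
  cases m with
  | zero => simp [qPoch]
  | succ m => simp [qPoch_succ']

/-- Coefficientwise this is a `q`-Pascal rule. It removes the last factor of (X;q)_{k+1}, so that
induction on k gives the `q`-binomial theorem without infinite products. -/
theorem qBinomSeries_succ_mul {q : ℂ} (hq : ∀ m : ℕ, q ^ (m + 1) ≠ 1) (k : ℕ) :
    qBinomSeries q (k + 1) * (1 - C (q ^ k) * X) = qBinomSeries q k := by
  ext m
  rw [mul_sub, mul_one, map_sub, mul_left_comm, coeff_C_mul]
  cases m with
  | zero => simp [qBinomSeries, qPoch]
  | succ m =>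
    rw [coeff_succ_mul_X]
    simp only [qBinomSeries, coeff_mk]
    have h1 := qPoch_self_ne_zero hq m
    have h2 := qPoch_self_ne_zero hq (m + 1)
    rw [qPoch_succ] at h2
    rw [qPoch_succ, qPoch_succ q q, qPoch_succ' (q ^ k), ← pow_succ]
    have h3 := (mul_ne_zero_iff.1 h2).2
    rw [pow_succ]
    generalize q ^ m = Q at *
    field_simp
    ring

theorem qBinomSeries_mul_prod {q : ℂ} (hq : ∀ m : ℕ, q ^ (m + 1) ≠ 1) (k : ℕ) :
    qBinomSeries q k * ∏ i ∈ Finset.range k, (1 - C (q ^ i) * X) = 1 := by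
  induction k with
  | zero => simp [qBinomSeries_zero]
  | succ k ih => rw [Finset.prod_range_succ, mul_comm (∏ _ ∈ _, _), ← mul_assoc,
      qBinomSeries_succ_mul hq, ih]

theorem rescale_C_mul_X (a b : ℂ) : rescale a (C b * X : ℂ⟦X⟧) = C (b * a) * X := by
  rw [map_mul, rescale_X, ← mul_assoc, map_mul]
  congr 2
  ext m
  rw [coeff_rescale, coeff_C]
  split_ifs with h <;> simp [h]

theorem rescale_one_sub (a b : ℂ) : rescale a (1 - C b * X : ℂ⟦X⟧) = 1 - C (b * a) * X := by
  rw [map_sub, map_one, rescale_C_mul_X]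

theorem rescale_qBinomSeries_mul_prod {q : ℂ} (hq : ∀ m : ℕ, q ^ (m + 1) ≠ 1) (k : ℕ) (z : ℂ) :
    rescale z (qBinomSeries q k) * ∏ i ∈ Finset.range k, (1 - C (z * q ^ i) * X) = 1 := by
  have h := congrArg (rescale z) (qBinomSeries_mul_prod hq k)
  rw [map_mul, map_prod, map_one] at h
  simpa only [rescale_one_sub, mul_comm _ z] using h

/-- The `q`-shift of the generating series `1 / (zX; q)_k`. -/
theorem rescale_mul_qBinomSeries {q : ℂ} (hq : ∀ m : ℕ, q ^ (m + 1) ≠ 1) (k : ℕ) (z : ℂ) :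
    rescale (q * z) (qBinomSeries q k) * (1 - C (q ^ k * z) * X) =
      rescale z (qBinomSeries q k) * (1 - C z * X) := by
  have h1 := rescale_qBinomSeries_mul_prod hq k z
  have h2 := rescale_qBinomSeries_mul_prod hq k (q * z)
  have h3 : (∏ i ∈ Finset.range k, (1 - C (q * z * q ^ i) * X)) * (1 - C z * X) =
      (∏ i ∈ Finset.range k, (1 - C (z * q ^ i) * X)) * (1 - C (q ^ k * z) * X : ℂ⟦X⟧) := by
    have a1 := Finset.prod_range_succ (fun i => (1 - C (z * q ^ i) * X : ℂ⟦X⟧)) k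
    have a2 := Finset.prod_range_succ' (fun i => (1 - C (z * q ^ i) * X : ℂ⟦X⟧)) k
    rw [a1] at a2
    rw [mul_comm (q ^ k), a2, pow_zero, mul_one]
    congr 1
    refine Finset.prod_congr rfl fun i _ => ?_
    rw [pow_succ']
    congr 3
    ring
  calc _ = rescale (q * z) (qBinomSeries q k) * (1 - C (q ^ k * z) * X) *
        (rescale z (qBinomSeries q k) * ∏ i ∈ Finset.range k, (1 - C (z * q ^ i) * X)) := by
        rw [h1, mul_one]
    _ = rescale (q * z) (qBinomSeries q k) * rescale z (qBinomSeries q k) *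
        ((∏ i ∈ Finset.range k, (1 - C (z * q ^ i) * X)) * (1 - C (q ^ k * z) * X)) := by ring
    _ = (rescale (q * z) (qBinomSeries q k) * ∏ i ∈ Finset.range k, (1 - C (q * z * q ^ i) * X)) *
        (rescale z (qBinomSeries q k) * (1 - C z * X)) := by rw [← h3]; ring
    _ = _ := by rw [h2, one_mul]

/-! ### The row polynomials g_m and their eigenvalue equation -/

section Row

variable {n : ℕ}

/-- Evaluation at a point of the torus, as an algebra homomorphism. -/
def Laurent.evalHom (y : Fin n → ℂ) (hy : ∀ i, y i ≠ 0) : Laurent n →ₐ[ℂ] ℂ :=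
  AddMonoidAlgebra.lift ℂ ℂ (Fin n → ℤ)
    { toFun := fun ν => ∏ i, y i ^ ν.toAdd i
      map_one' := by simp
      map_mul' := fun μ ν => by
        rw [← Finset.prod_mul_distrib]
        exact Finset.prod_congr rfl fun i _ => zpow_add₀ (hy i) _ _ }

theorem Laurent.evalHom_apply (y : Fin n → ℂ) (hy : ∀ i, y i ≠ 0) (P : Laurent n) :
    Laurent.evalHom y hy P = P.eval y := by
  rw [Laurent.evalHom, AddMonoidAlgebra.lift_apply]
  rfl

/-- The generating series `∏_p 1 / (z_p X; q)_k` over a commutative `ℂ`-algebra. -/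
def rowSeries {ι A : Type*} [Fintype ι] [CommRing A] [Algebra ℂ A] (q : ℂ) (k : ℕ) (z : ι → A) :
    A⟦X⟧ := ∏ p, PowerSeries.mk fun m => algebraMap ℂ A (coeff m (qBinomSeries q k)) * z p ^ m

/-- Functoriality in the coefficient algebra is used twice: for evaluation at a point of the torus,
and for the automorphisms given by signed permutations. -/
theorem map_rowSeries {ι A B : Type*} [Fintype ι] [CommRing A] [Algebra ℂ A] [CommRing B]
    [Algebra ℂ B] (φ : A →ₐ[ℂ] B) (q : ℂ) (k : ℕ) (z : ι → A) :
    PowerSeries.map (φ : A →+* B) (rowSeries q k z) = rowSeries q k fun p => φ (z p) := by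
  rw [rowSeries, map_prod, rowSeries]
  refine Finset.prod_congr rfl fun p _ => ?_
  ext m
  simp

theorem rowSeries_eq_prod_rescale {ι : Type*} [Fintype ι] (q : ℂ) (k : ℕ) (z : ι → ℂ) :
    rowSeries q k z = ∏ p, rescale (z p) (qBinomSeries q k) := by
  refine Finset.prod_congr rfl fun p _ => ?_
  ext m
  simp [mul_comm]

/-- The variable `y_i^s` as a Laurent polynomial. -/
def Laurent.var (p : Fin n × ℤˣ) : Laurent n :=
  AddMonoidAlgebra.single (Pi.single p.1 (p.2 : ℤ)) 1

theorem Laurent.evalHom_var (y : Fin n → ℂ) (hy : ∀ i, y i ≠ 0) (p : Fin n × ℤˣ) :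
    Laurent.evalHom y hy (Laurent.var p) = y p.1 ^ (p.2 : ℤ) := by
  rw [Laurent.evalHom, Laurent.var, AddMonoidAlgebra.lift_single, one_smul]
  change ∏ i, y i ^ (Pi.single p.1 (p.2 : ℤ) : Fin n → ℤ) i = _
  rw [Finset.prod_eq_single p.1 (fun i _ hi => by simp [hi]) (by simp), Pi.single_eq_same]

/-- The coefficient `g_m` of `∏_j 1 / ((y_j X; q)_k (y_j⁻¹ X; q)_k)`. -/
def rowLaurent (n : ℕ) (q : ℂ) (k m : ℕ) : Laurent n :=
  coeff m (rowSeries q k (Laurent.var (n := n)))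

theorem eval_rowLaurent (q : ℂ) (k m : ℕ) (y : Fin n → ℂ) (hy : ∀ i, y i ≠ 0) :
    (rowLaurent n q k m).eval y =
      coeff m (∏ i, ∏ s : ℤˣ, rescale (y i ^ (s : ℤ)) (qBinomSeries q k)) := by
  have h := congrArg (coeff m)
    (map_rowSeries (Laurent.evalHom y hy) q k (Laurent.var (n := n)))
  rw [coeff_map] at h
  rw [← Laurent.evalHom_apply y hy]
  refine h.trans ?_
  rw [rowSeries_eq_prod_rescale, Fintype.prod_prod_type]
  simp only [Laurent.evalHom_var]

theorem prod_units_rescale (q : ℂ) (k : ℕ) (x : ℂ) (a : ℤˣ) :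
    ∏ s : ℤˣ, rescale ((x ^ (a : ℤ)) ^ (s : ℤ)) (qBinomSeries q k) =
      rescale x (qBinomSeries q k) * rescale x⁻¹ (qBinomSeries q k) := by
  rw [prod_units_int]
  have := zpow_units_symm (fun u v => rescale u (qBinomSeries q k) * rescale v (qBinomSeries q k))
    (fun u v => mul_comm _ _) x a
  simpa using this

/-- The generating series of the `g_m` satisfies Macdonald's `q`-difference equation. -/
theorem sum_shiftCoeff_mul_rescale {q : ℂ} (hq : ∀ m : ℕ, q ^ (m + 1) ≠ 1) (hq0 : q ≠ 0) {k : ℕ}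
    (hk : 1 ≤ k) {r : ℂ} (hr : r * r = q) (y : Fin (n + 1) → ℂ) (hy : IsRegularPoint y) :
    ∑ a, C (shiftCoeff (q ^ k) (signPow y a)) * rescale r (∏ j, (rescale (r * signPow y a j)
        (qBinomSeries q k) * rescale (r * signPow y a j)⁻¹ (qBinomSeries q k))) =
      C (∏ i ∈ Finset.range n, (1 + (q ^ k) ^ (i + 1))) *
        (∏ j, rescale (y j) (qBinomSeries q k) * rescale (y j)⁻¹ (qBinomSeries q k) +
        C ((q ^ k) ^ (n + 1)) * rescale q (∏ j, (rescale (y j) (qBinomSeries q k) *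
          rescale (y j)⁻¹ (qBinomSeries q k)))) := by
  set t := q ^ k with ht
  have ht0 : t ≠ 0 := pow_ne_zero _ hq0
  have htn : ∀ m : ℕ, t ^ (m + 1) ≠ 1 := by
    intro m
    obtain ⟨l, rfl⟩ : ∃ l, k = l + 1 := ⟨k - 1, by omega⟩
    rw [ht, ← pow_mul]
    have := hq ((l + 1) * (m + 1) - 1)
    rwa [Nat.sub_add_cancel (Nat.mul_pos l.succ_pos m.succ_pos)] at this
  have hr0 : r ≠ 0 := by rintro rfl; exact hq0 (by simpa using hr.symm)
  set G := ∏ j, rescale (y j) (qBinomSeries q k) * rescale (y j)⁻¹ (qBinomSeries q k) with hG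
  set Dn : ℂ⟦X⟧ := ∏ j, (1 - C (t * y j) * X) * (1 - C (t * (y j)⁻¹) * X) with hDn
  have hDn0 : Dn ≠ 0 := by
    intro h
    have := congrArg constantCoeff h
    rw [hDn, map_prod] at this
    simp at this
  have hshift : ∀ z : ℂ, rescale (q * z) (qBinomSeries q k) * (1 - C (t * z) * X) =
      rescale z (qBinomSeries q k) * (1 - C z * X) := rescale_mul_qBinomSeries hq k
  -- Rescaling by r turns the pair rz, (rz)⁻¹ into qz, z⁻¹. Only one member of each pair is shifted,
  -- at the cost of a factor (1 - zX)/(1 - tzX) whose denominator divides `Dn`.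
  have h1 : ∀ a, Dn * rescale r (∏ j, (rescale (r * signPow y a j)
        (qBinomSeries q k) * rescale (r * signPow y a j)⁻¹ (qBinomSeries q k))) =
      G * ∏ j, (1 - C (signPow y a j) * X) * (1 - C (t * (signPow y a j)⁻¹) * X) := by
    intro a
    rw [map_prod, hDn, hG, ← Finset.prod_mul_distrib, ← Finset.prod_mul_distrib]
    refine Finset.prod_congr rfl fun j _ => ?_
    set z := signPow y a j with hz
    have e1 : (1 - C (t * y j) * X) * (1 - C (t * (y j)⁻¹) * X)
        = (1 - C (t * z) * X) * (1 - C (t * z⁻¹) * X : ℂ⟦X⟧) :=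
      (zpow_units_symm (fun u v => (1 - C (t * u) * X) * (1 - C (t * v) * X : ℂ⟦X⟧))
        (fun u v => mul_comm _ _) (y j) (a j)).symm
    have e2 : rescale (y j) (qBinomSeries q k) * rescale (y j)⁻¹ (qBinomSeries q k)
        = rescale z (qBinomSeries q k) * rescale z⁻¹ (qBinomSeries q k) :=
      (zpow_units_symm (fun u v => rescale u (qBinomSeries q k) * rescale v (qBinomSeries q k))
        (fun u v => mul_comm _ _) (y j) (a j)).symm
    have e3 : rescale r (rescale (r * z) (qBinomSeries q k)) =
        rescale (q * z) (qBinomSeries q k) := by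
      rw [rescale_rescale, ← hr]
      congr 2
      ring
    have e4 : rescale r (rescale (r * z)⁻¹ (qBinomSeries q k)) =
        rescale z⁻¹ (qBinomSeries q k) := by
      rw [rescale_rescale]
      congr 2
      field_simp
    rw [map_mul (rescale r), e1, e2, e3, e4]
    linear_combination (1 - C (t * z⁻¹) * X) * rescale z⁻¹ (qBinomSeries q k) * hshift z
  -- Here both members of each pair are shifted, and `Dn` is exactly the denominator.
  have h2 : Dn * rescale q G = G * ∏ j, (1 - C (y j) * X) * (1 - C (y j)⁻¹ * X) := by
    rw [hG, map_prod, hDn, ← Finset.prod_mul_distrib, ← Finset.prod_mul_distrib]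
    refine Finset.prod_congr rfl fun j _ => ?_
    rw [map_mul (rescale q), rescale_rescale, rescale_rescale, mul_comm (y j) q, mul_comm (y j)⁻¹ q]
    linear_combination (1 - C (t * (y j)⁻¹) * X) * rescale (q * (y j)⁻¹) (qBinomSeries q k) * hshift (y j)
      + rescale (y j) (qBinomSeries q k) * (1 - C (y j) * X) * hshift (y j)⁻¹
  have hid := congrArg (fun p : Polynomial ℂ => (p : ℂ⟦X⟧)) (sum_shiftCoeff_mul_prod t ht0 htn y hy)
  simp only [← Polynomial.coeToPowerSeries.ringHom_apply, map_sum, map_mul, map_add, map_prod,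
    map_sub, map_one] at hid
  simp only [Polynomial.coeToPowerSeries.ringHom_apply, Polynomial.coe_C, Polynomial.coe_X] at hid
  refine mul_left_cancel₀ hDn0 ?_
  rw [Finset.mul_sum]
  simp only [mul_left_comm Dn, mul_add, h2]
  simp only [h1, mul_left_comm _ G, ← Finset.mul_sum]
  simp only [map_mul, map_prod, map_add, map_one, map_pow] at hDn hid ⊢
  rw [hid, hDn]
  ring

theorem sqrt_zpow_units {q : ℝ} (hq0 : 0 < q) (a : ℤˣ) :
    ((q ^ (((a : ℤ) : ℝ) / 2) : ℝ) : ℂ) = ((q ^ (1 / 2 : ℝ) : ℝ) : ℂ) ^ (a : ℤ) := by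
  rw [← Complex.ofReal_zpow, ← Real.rpow_intCast, ← Real.rpow_mul hq0.le]
  congr 2
  ring

/-- Since a_i² = 1, the half shift multiplies y_i^{a_i} by q^{1/2} whatever the sign; the outer
power a_i then disappears from symmetric expressions. -/
theorem halfShift_eq {q : ℝ} (hq0 : 0 < q) (a : Fin n → ℤˣ) (y : Fin n → ℂ) (i : Fin n) :
    halfShift q a y i = (((q ^ (1 / 2 : ℝ) : ℝ) : ℂ) * signPow y a i) ^ (a i : ℤ) := by
  rw [halfShift, sqrt_zpow_units hq0, mul_zpow, signPow, ← zpow_mul, ← Units.val_mul,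
    Int.units_mul_self]
  simp

theorem halfShift_ne_zero {q : ℝ} (hq0 : 0 < q) (a : Fin n → ℤˣ) {y : Fin n → ℂ}
    (hy : ∀ i, y i ≠ 0) (i : Fin n) : halfShift q a y i ≠ 0 :=
  mul_ne_zero (Complex.ofReal_ne_zero.2 (Real.rpow_pos_of_pos hq0 _).ne') (hy i)

theorem macdonaldE_eq (q t : ℝ) (f : (Fin n → ℂ) → ℂ) (y : Fin n → ℂ) :
    macdonaldE q t f y = ∑ a, shiftCoeff t (signPow y a) * f (halfShift q a y) := by
  refine Finset.sum_congr rfl fun a _ => ?_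
  simp only [shiftCoeff, signPow, mul_comm (2 : ℤ), zpow_mul]
  rfl

theorem eigenvalueC_rowPartition {q : ℝ} (hq0 : 0 < q) (t : ℝ) (m : ℕ) :
    eigenvalueC q t (rowPartition (n + 1) m) =
      ((q ^ (1 / 2 : ℝ)) ^ m)⁻¹ * ((1 + t ^ (n + 1) * q ^ m) *
        ∏ i ∈ Finset.range n, (1 + t ^ (i + 1))) := by
  have hs : ∑ i, rowPartition (n + 1) m i = m := by
    rw [Fin.sum_univ_succ]
    simp [rowPartition]
  rw [eigenvalueC, hs, Fin.prod_univ_succ]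
  congr 1
  · rw [← Real.rpow_natCast, ← Real.rpow_mul hq0.le, ← Real.rpow_neg hq0.le]
    congr 1
    push_cast
    ring
  · congr 1
    · simp [rowPartition, mul_comm]
    · rw [← Finset.prod_range_reflect, ← Fin.prod_univ_eq_prod_range
        (fun j => 1 + t ^ (n - 1 - j + 1))]
      refine Finset.prod_congr rfl fun i _ => ?_
      have : n + 1 - ((i.succ : Fin (n + 1)) : ℕ) = n - 1 - i + 1 := by
        rw [Fin.val_succ]; omega
      rw [this]
      simp [rowPartition]

/-- `g_m` is an eigenfunction of `E`. -/
theorem macdonaldE_rowLaurent {q : ℝ} (hq0 : 0 < q) (hq1 : q < 1) {k : ℕ} (hk : 1 ≤ k) (m : ℕ)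
    (y : Fin (n + 1) → ℂ) (hy : IsRegularPoint y) :
    macdonaldE q (q ^ k) (rowLaurent (n + 1) q k m).eval y =
      (eigenvalueC q (q ^ k) (rowPartition (n + 1) m) : ℂ) * (rowLaurent (n + 1) q k m).eval y := by
  have hq : ∀ m : ℕ, (q : ℂ) ^ (m + 1) ≠ 1 := by
    intro m
    exact_mod_cast (pow_lt_one₀ hq0.le hq1 m.succ_ne_zero).ne
  set r : ℝ := q ^ (1 / 2 : ℝ) with hr
  have hr0 : (r : ℂ) ≠ 0 := Complex.ofReal_ne_zero.2 (Real.rpow_pos_of_pos hq0 _).ne'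
  have hrr : (r : ℂ) * r = q := by
    rw [← Complex.ofReal_mul, hr, ← Real.rpow_add hq0]
    norm_num
  have h := congrArg (coeff m)
    (sum_shiftCoeff_mul_rescale hq (Complex.ofReal_ne_zero.2 hq0.ne') hk hrr y hy)
  have hy' : (rowLaurent (n + 1) q k m).eval y = coeff m
      (∏ j, rescale (y j) (qBinomSeries q k) * rescale (y j)⁻¹ (qBinomSeries q k)) := by
    rw [eval_rowLaurent _ _ _ _ hy.1]
    congr 1
    refine Finset.prod_congr rfl fun j _ => ?_
    simpa only [Units.val_one, zpow_one] using prod_units_rescale q k (y j) 1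
  have ha : ∀ a, (rowLaurent (n + 1) q k m).eval (halfShift q a y) = coeff m
      (∏ j, (rescale (r * signPow y a j) (qBinomSeries q k) *
        rescale (r * signPow y a j)⁻¹ (qBinomSeries q k))) := by
    intro a
    rw [eval_rowLaurent _ _ _ _ (halfShift_ne_zero hq0 a hy.1)]
    congr 1
    refine Finset.prod_congr rfl fun j _ => ?_
    rw [halfShift_eq hq0]
    exact prod_units_rescale q k _ (a j)
  simp only [map_sum, coeff_C_mul, coeff_rescale, map_add, ← ha, ← hy'] at h
  rw [macdonaldE_eq, eigenvalueC_rowPartition hq0]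
  push_cast
  -- The power r^m produced by rescaling X by r = q^{1/2} accounts for the prefactor q^{-m/2} of the
  -- eigenvalue.
  rw [mul_assoc, eq_inv_mul_iff_mul_eq₀ (pow_ne_zero _ hr0), Finset.mul_sum]
  calc _ = _ := Finset.sum_congr rfl fun a _ => by ring
    _ = _ := h
    _ = _ := by ring

end Row

end

/-! ### Exponents and symmetry of g_m, and existence of the Macdonald polynomial -/

noncomputable section

open PowerSeries

variable {n : ℕ}

/-- The exponent of the monomial `∏_p (var p)^(l p)`. -/
def monomialExponent (l : Fin n × ℤˣ →₀ ℕ) : Fin n → ℤ :=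
  ∑ p, l p • (Pi.single p.1 (p.2 : ℤ) : Fin n → ℤ)

theorem monomialExponent_apply (l : Fin n × ℤˣ →₀ ℕ) (i : Fin n) :
    monomialExponent l i = l (i, 1) - l (i, -1) := by
  rw [monomialExponent, Finset.sum_apply, Fintype.sum_prod_type, Finset.sum_eq_single i]
  · rw [show (Finset.univ : Finset ℤˣ) = {1, -1} from rfl, Finset.sum_pair (by decide)]
    simp [sub_eq_add_neg]
  · intro j _ hj
    simp [hj.symm]
  · simp

theorem rowLaurent_eq_sum (q : ℂ) (k m : ℕ) :
    rowLaurent n q k m = ∑ l ∈ (Finset.univ : Finset (Fin n × ℤˣ)).finsuppAntidiag m,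
      AddMonoidAlgebra.single (monomialExponent l) (∏ p, coeff (l p) (qBinomSeries q k)) := by
  rw [rowLaurent, rowSeries, coeff_prod]
  refine Finset.sum_congr rfl fun l _ => ?_
  rw [monomialExponent, ← AddMonoidAlgebra.prod_single]
  refine Finset.prod_congr rfl fun p _ => ?_
  rw [coeff_mk, Laurent.var, AddMonoidAlgebra.single_pow, one_pow, ← Algebra.smul_def,
    AddMonoidAlgebra.smul_single, smul_eq_mul, mul_one]

theorem sum_coe_pairs (l : Fin n × ℤˣ →₀ ℕ) : ∑ p, l p = ∑ i, (l (i, 1) + l (i, -1)) := by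
  rw [Fintype.sum_prod_type]
  refine Finset.sum_congr rfl fun i _ => ?_
  rw [show (Finset.univ : Finset ℤˣ) = {1, -1} from rfl, Finset.sum_pair (by decide)]

/-- A monomial of g_m distributes total degree m over the 2n variables y_i and y_i⁻¹. The size bound
and the parity of the exponents both follow from this. -/
theorem exists_of_coeff_rowLaurent_ne_zero {q : ℂ} {k m : ℕ} {κ : Fin n → ℤ}
    (h : (rowLaurent n q k m).coeff κ ≠ 0) :
    ∃ l : Fin n × ℤˣ →₀ ℕ, ∑ i, (l (i, 1) + l (i, -1)) = m ∧ ∀ i, κ i = l (i, 1) - l (i, -1) := by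
  rw [rowLaurent_eq_sum, AddMonoidAlgebra.coeff_sum, Finset.sum_apply'] at h
  obtain ⟨l, hl, hne⟩ := Finset.exists_ne_zero_of_sum_ne_zero h
  rw [Finset.mem_finsuppAntidiag] at hl
  refine ⟨l, by rw [← sum_coe_pairs]; exact hl.1, fun i => ?_⟩
  rw [← monomialExponent_apply]
  by_contra hi
  refine hne ?_
  rw [AddMonoidAlgebra.coeff_single, Finsupp.single_eq_of_ne]
  rintro rfl
  exact hi rfl

theorem sum_abs_le_of_coeff_rowLaurent_ne_zero {q : ℂ} {k m : ℕ} {κ : Fin n → ℤ}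
    (h : (rowLaurent n q k m).coeff κ ≠ 0) : ∑ i, |κ i| ≤ m := by
  obtain ⟨l, hl, hκ⟩ := exists_of_coeff_rowLaurent_ne_zero h
  rw [← hl]
  push_cast
  refine Finset.sum_le_sum fun i _ => ?_
  rw [hκ, abs_le]
  constructor <;> linarith [Int.natCast_nonneg (l (i, 1)), Int.natCast_nonneg (l (i, -1))]

theorem even_of_coeff_rowLaurent_ne_zero {q : ℂ} {k m : ℕ} {κ : Fin n → ℤ}
    (h : (rowLaurent n q k m).coeff κ ≠ 0) : Even ((m : ℤ) - ∑ i, κ i) := by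
  obtain ⟨l, hl, hκ⟩ := exists_of_coeff_rowLaurent_ne_zero h
  refine ⟨∑ i, (l (i, -1) : ℤ), ?_⟩
  rw [← hl]
  push_cast
  rw [← Finset.sum_sub_distrib, ← Finset.sum_add_distrib]
  refine Finset.sum_congr rfl fun i _ => ?_
  rw [hκ]
  ring

theorem coeff_rowLaurent_rowPartition (q : ℂ) (k m : ℕ) :
    (rowLaurent (n + 1) q k m).coeff (rowPartition (n + 1) m) = coeff m (qBinomSeries q k) := by
  rw [rowLaurent_eq_sum, AddMonoidAlgebra.coeff_sum, Finset.sum_apply',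
    Finset.sum_eq_single (Finsupp.single ((0 : Fin (n + 1)), (1 : ℤˣ)) m)]
  · have : monomialExponent (Finsupp.single ((0 : Fin (n + 1)), (1 : ℤˣ)) m) =
        rowPartition (n + 1) m := by
      ext i
      rw [monomialExponent_apply, rowPartition]
      simp only [Finsupp.single_apply, Prod.mk.injEq, Fin.ext_iff, Fin.val_zero]
      by_cases hi : (i : ℕ) = 0 <;> simp [hi, eq_comm]
    rw [this, AddMonoidAlgebra.coeff_single, Finsupp.single_eq_same,
      Finset.prod_eq_single ((0 : Fin (n + 1)), (1 : ℤˣ))]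
    · simp
    · intro p _ hp
      rw [Finsupp.single_eq_of_ne hp]
      simp [qBinomSeries, qPoch]
    · simp
  · intro l hl hne
    rw [Finset.mem_finsuppAntidiag] at hl
    rw [AddMonoidAlgebra.coeff_single, Finsupp.single_eq_of_ne]
    intro heq
    refine hne ?_
    have h0 := congrFun heq 0
    rw [monomialExponent_apply] at h0
    simp only [rowPartition, Fin.val_zero, if_true] at h0
    have hsum := hl.1
    rw [← Finset.add_sum_erase _ _ (Finset.mem_univ ((0 : Fin (n + 1)), (1 : ℤˣ)))] at hsum
    -- Reaching exponent m in y_1 with total degree m forces the whole degree onto y_1, so exactly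
    -- one term contributes.
    have hrest : ∑ p ∈ Finset.univ.erase ((0 : Fin (n + 1)), (1 : ℤˣ)), l p = 0 := by omega
    rw [Finset.sum_eq_zero_iff] at hrest
    ext p
    by_cases hp : p = (0, 1)
    · subst hp
      rw [Finsupp.single_eq_same]
      omega
    · rw [Finsupp.single_eq_of_ne hp]
      exact hrest p (by simp [hp])
  · intro h
    exact absurd (by simp [Finset.mem_finsuppAntidiag, Finsupp.single_apply]) h

/-- The action of a signed permutation on weights. -/
def signedPermEquiv (a : Fin n → ℤˣ) (σ : Equiv.Perm (Fin n)) : (Fin n → ℤ) ≃+ (Fin n → ℤ) where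
  toFun ν i := (a i : ℤ) * ν (σ i)
  invFun ν i := (a (σ.symm i) : ℤ) * ν (σ.symm i)
  left_inv ν := by
    ext i
    simp only [Equiv.apply_symm_apply, ← mul_assoc, ← Units.val_mul, Int.units_mul_self,
      Units.val_one, one_mul]
  right_inv ν := by
    ext i
    simp only [Equiv.symm_apply_apply, ← mul_assoc, ← Units.val_mul, Int.units_mul_self,
      Units.val_one, one_mul]
  map_add' ν ν' := by
    ext i
    simp [mul_add]

/-- The action of a signed permutation on the `2n` variables `y_i^{±1}`. -/
def signedPermVars (a : Fin n → ℤˣ) (σ : Equiv.Perm (Fin n)) : Fin n × ℤˣ ≃ Fin n × ℤˣ where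
  toFun p := (σ.symm p.1, a (σ.symm p.1) * p.2)
  invFun p := (σ p.1, a p.1 * p.2)
  left_inv p := by simp [← mul_assoc, Int.units_mul_self]
  right_inv p := by simp [← mul_assoc, Int.units_mul_self]

/-- Invariance under signed permutations. -/
def IsWeylInvariant (F : Laurent n) : Prop :=
  ∀ (a : Fin n → ℤˣ) (σ : Equiv.Perm (Fin n)) (κ : Fin n → ℤ),
    F.coeff (fun i => (a i : ℤ) * κ (σ i)) = F.coeff κ

/-- A signed permutation acts on the Laurent ring by an automorphism that merely permutes the 2n
variables, and the generating product runs over all of them. -/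
theorem isWeylInvariant_rowLaurent (q : ℂ) (k m : ℕ) : IsWeylInvariant (rowLaurent n q k m) := by
  intro a σ κ
  set φ : Laurent n ≃ₐ[ℂ] Laurent n := AddMonoidAlgebra.domCongr ℂ ℂ (signedPermEquiv a σ) with hφ
  have hvar : ∀ p, φ (Laurent.var p) = Laurent.var (signedPermVars a σ p) := by
    rintro ⟨j, s⟩
    rw [hφ, Laurent.var, AddMonoidAlgebra.domCongr_single, Laurent.var]
    congr 1
    ext i
    simp only [signedPermEquiv, signedPermVars, AddEquiv.coe_mk, Equiv.coe_fn_mk, Pi.single_apply,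
      Equiv.eq_symm_apply]
    split_ifs with h
    · subst h
      simp
    · simp
  have h : φ (rowLaurent n q k m) = rowLaurent n q k m := by
    have h := congrArg (coeff m)
      (map_rowSeries (φ : Laurent n →ₐ[ℂ] Laurent n) q k (Laurent.var (n := n)))
    rw [coeff_map] at h
    refine h.trans ?_
    rw [rowLaurent, rowSeries, rowSeries]
    congr 1
    rw [← (signedPermVars a σ).prod_comp (fun p => PowerSeries.mk fun m =>
      algebraMap ℂ (Laurent n) (coeff m (qBinomSeries q k)) * Laurent.var p ^ m)]
    exact Finset.prod_congr rfl fun p _ => by rw [← hvar]; rfl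
  conv_lhs => rw [← h]
  rw [hφ, AddMonoidAlgebra.coeff_domCongr]
  congr 1
  exact (signedPermEquiv a σ).symm_apply_apply κ

theorem coeff_orbitSum (ν κ : Fin n → ℤ) :
    (orbitSum ν).coeff κ = if κ ∈ weylOrbit ν then 1 else 0 := by
  rw [orbitSum, AddMonoidAlgebra.coeff_sum, Finset.sum_apply']
  simp [Finsupp.single_apply]

theorem mem_weylOrbit {ν κ : Fin n → ℤ} :
    κ ∈ weylOrbit ν ↔ ∃ (a : Fin n → ℤˣ) (σ : Equiv.Perm (Fin n)), κ = fun i => (a i : ℤ) * ν (σ i) := by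
  simp [weylOrbit, eq_comm]

theorem abs_units_mul (a : ℤˣ) (x : ℤ) : |(a : ℤ) * x| = |x| := by
  rcases Int.units_eq_one_or a with rfl | rfl <;> simp

/-- Every orbit contains a partition. -/
theorem exists_isPartition_mem_weylOrbit (κ : Fin n → ℤ) :
    ∃ ν, IsPartition ν ∧ κ ∈ weylOrbit ν := by
  set f : Fin n → ℤ := fun i => -|κ i| with hf
  have hmono := Tuple.monotone_sort f
  refine ⟨fun i => |κ (Tuple.sort f i)|, ⟨fun i j hij => ?_, fun i => abs_nonneg _⟩, ?_⟩
  · have := hmono hij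
    simp only [Function.comp, hf] at this
    linarith
  · rw [mem_weylOrbit]
    refine ⟨fun i => if 0 ≤ κ i then 1 else -1, (Tuple.sort f).symm, ?_⟩
    ext i
    simp only [Equiv.apply_symm_apply]
    split_ifs with h
    · simp [abs_of_nonneg h]
    · simp [abs_of_neg (not_le.1 h)]

/-- Every orbit contains at most one partition. -/
theorem IsPartition.eq_of_mem_weylOrbit {ν ν' κ : Fin n → ℤ} (hν : IsPartition ν)
    (hν' : IsPartition ν') (h : κ ∈ weylOrbit ν) (h' : κ ∈ weylOrbit ν') : ν = ν' := by
  obtain ⟨a, σ, rfl⟩ := mem_weylOrbit.1 h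
  obtain ⟨a', σ', h'⟩ := mem_weylOrbit.1 h'
  have key : ∀ i, ν i = ν' (σ' (σ.symm i)) := by
    intro i
    have := congrArg abs (congrFun h' (σ.symm i))
    simpa only [abs_units_mul, Equiv.apply_symm_apply, abs_of_nonneg (hν.2 _),
      abs_of_nonneg (hν'.2 _)] using this
  have := Tuple.unique_monotone (f := fun i => OrderDual.toDual (ν' i)) (σ := 1)
    (τ := σ' * σ⁻¹) (fun i j hij => hν'.1 hij) (fun i j hij => by
      have := hν.1 hij
      rw [key i, key j] at this
      exact this)
  ext i
  rw [key]
  exact (congrFun this i).symm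

open Classical in
/-- A Weyl invariant Laurent polynomial is a combination of orbit sums of partitions. -/
theorem IsWeylInvariant.eq_sum_orbitSum {F : Laurent n} (hF : IsWeylInvariant F) :
    F = (F.coeff.filter IsPartition).sum fun ν c => c • orbitSum ν := by
  apply AddMonoidAlgebra.coeff_injective
  ext κ
  obtain ⟨ν, hν, hκ⟩ := exists_isPartition_mem_weylOrbit κ
  have hFκ : F.coeff κ = F.coeff ν := by
    obtain ⟨a, σ, rfl⟩ := mem_weylOrbit.1 hκ
    exact hF a σ ν
  rw [Finsupp.sum, AddMonoidAlgebra.coeff_sum, Finset.sum_apply', Finset.sum_eq_single ν]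
  · simp [coeff_orbitSum, hκ, hν, hFκ]
  · intro ν' hν' hne
    rw [Finsupp.support_filter, Finset.mem_filter] at hν'
    have : κ ∉ weylOrbit ν' := fun h => hne (hν'.2.eq_of_mem_weylOrbit hν h hκ)
    simp [coeff_orbitSum, this]
  · intro h
    rw [Finsupp.notMem_support_iff] at h
    simp [h]

theorem isPartition_rowPartition (n m : ℕ) : IsPartition (rowPartition n m) := by
  refine ⟨fun i j hij => ?_, fun i => ?_⟩
  · simp only [rowPartition]
    have : (i : ℕ) ≤ j := hij
    split_ifs <;> omega
  · simp only [rowPartition]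
    split_ifs <;> omega

theorem mem_weylOrbit_self (ν : Fin n → ℤ) : ν ∈ weylOrbit ν :=
  mem_weylOrbit.2 ⟨1, 1, by simp⟩

theorem sum_rowPartition (n m : ℕ) : ∑ i, rowPartition (n + 1) m i = m := by
  rw [Fin.sum_univ_succ]
  simp [rowPartition]

/-- Partitions of `m`, `m - 2`, … are dominated by `(m, 0, …, 0)`. -/
theorem dominatedBy_rowPartition {m : ℕ} {ν : Fin (n + 1) → ℤ} (hν : IsPartition ν)
    (hne : ν ≠ rowPartition (n + 1) m) (hle : ∑ i, ν i ≤ m) (heven : Even ((m : ℤ) - ∑ i, ν i)) :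
    DominatedBy ν (rowPartition (n + 1) m) := by
  refine ⟨hne, ?_⟩
  obtain ⟨d, hd⟩ := heven
  have hd0 : 0 ≤ d := by omega
  -- With m - |ν| = 2d, each later part of ν is moved to the first place by roots ε_1 - ε_i, and the
  -- remaining 2d is filled up by d copies of 2ε_1.
  have key : rowPartition (n + 1) m - ν = d.toNat • (Pi.single 0 2 : Fin (n + 1) → ℤ) +
      ∑ i : Fin n, (ν i.succ).toNat • ((Pi.single 0 1 - Pi.single i.succ 1 : Fin (n + 1) → ℤ)) := by
    ext j
    have hmax : ∀ i, max (ν i) 0 = ν i := fun i => max_eq_left (hν.2 i)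
    rw [Fin.sum_univ_succ] at hd
    induction j using Fin.cases with
    | zero =>
      simp [rowPartition, hmax, max_eq_left hd0]
      linarith
    | succ j => simp [rowPartition, hmax, Pi.single_apply, Finset.sum_ite_eq]
  rw [key]
  have hroot : ∀ α ∈ positiveRoots (n + 1), α ∈ positiveCone (n + 1) :=
    fun α hα => AddSubmonoid.subset_closure hα
  exact add_mem (nsmul_mem (hroot _ (Or.inr ⟨0, rfl⟩)) _)
    (sum_mem fun i _ => nsmul_mem (hroot _ (Or.inl ⟨0, i.succ, i.succ_pos, Or.inl rfl⟩)) _)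

/-- Every positive root has coordinate sum 0 or 2. -/
theorem DominatedBy.sum_le {ν μ : Fin n → ℤ} (h : DominatedBy ν μ) : ∑ i, ν i ≤ ∑ i, μ i := by
  have key : ∀ α ∈ positiveCone n, 0 ≤ ∑ i, α i := by
    intro α hα
    induction hα using AddSubmonoid.closure_induction with
    | mem α hα =>
      rcases hα with ⟨i, j, -, rfl | rfl⟩ | ⟨i, rfl⟩ <;>
        simp [Finset.sum_sub_distrib, Finset.sum_add_distrib]
    | zero => simp
    | add α β _ _ hα hβ =>
      simp only [Pi.add_apply, Finset.sum_add_distrib]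
      exact add_nonneg hα hβ
  have := key _ h.2
  simp only [Pi.sub_apply, Finset.sum_sub_distrib] at this
  linarith

theorem macdonaldE_smul (q t : ℝ) (hq0 : 0 < q) (c : ℂ) (P : Laurent n) (y : Fin n → ℂ)
    (hy : ∀ i, y i ≠ 0) : macdonaldE q t (c • P).eval y = c * macdonaldE q t P.eval y := by
  rw [macdonaldE_eq, macdonaldE_eq, Finset.mul_sum]
  refine Finset.sum_congr rfl fun a _ => ?_
  rw [← Laurent.evalHom_apply _ (halfShift_ne_zero hq0 a hy), map_smul, Laurent.evalHom_apply,
    smul_eq_mul]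
  ring

theorem Laurent.eval_smul (c : ℂ) (P : Laurent n) (y : Fin n → ℂ)
    (hy : ∀ i, y i ≠ 0) : (c • P).eval y = c * P.eval y := by
  rw [← Laurent.evalHom_apply _ hy, map_smul, Laurent.evalHom_apply, smul_eq_mul]

/-- The Macdonald polynomial of a row, from the generating function. -/
theorem isMacdonald_rowLaurent {q : ℝ} (hq0 : 0 < q) (hq1 : q < 1) {k : ℕ} (hk : 1 ≤ k) (m : ℕ)
    (hm : coeff m (qBinomSeries q k) ≠ 0) :
    IsMacdonald q (q ^ k) (rowPartition (n + 1) m)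
      ((coeff m (qBinomSeries q k))⁻¹ • rowLaurent (n + 1) q k m) := by
  classical
  set c := coeff m (qBinomSeries q k)
  set F := c⁻¹ • rowLaurent (n + 1) q k m with hF
  have hFc : ∀ κ, F.coeff κ = c⁻¹ * (rowLaurent (n + 1) q k m).coeff κ := fun κ => rfl
  have hFinv : IsWeylInvariant F := fun a σ κ => by
    rw [hFc, hFc, isWeylInvariant_rowLaurent]
  have hrow : F.coeff (rowPartition (n + 1) m) = 1 := by
    rw [hFc, coeff_rowLaurent_rowPartition, inv_mul_cancel₀ hm]
  refine ⟨⟨(F.coeff.filter IsPartition).erase (rowPartition (n + 1) m), ?_, ?_⟩, ?_⟩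
  · intro ν hν
    rw [Finsupp.support_erase, Finset.mem_erase, Finsupp.support_filter, Finset.mem_filter,
      Finsupp.mem_support_iff, hFc] at hν
    have h0 := (mul_ne_zero_iff.1 hν.2.1).2
    refine ⟨hν.2.2, dominatedBy_rowPartition hν.2.2 hν.1 ?_ (even_of_coeff_rowLaurent_ne_zero h0)⟩
    refine le_trans (Finset.sum_le_sum fun i _ => le_abs_self _)
      (sum_abs_le_of_coeff_rowLaurent_ne_zero h0)
  · have hsupp : rowPartition (n + 1) m ∈ (F.coeff.filter IsPartition).support := by
      rw [Finsupp.support_filter, Finset.mem_filter, Finsupp.mem_support_iff, hrow]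
      exact ⟨one_ne_zero, isPartition_rowPartition _ _⟩
    have h := Finsupp.add_sum_erase (F.coeff.filter IsPartition) _
      (fun ν c => c • orbitSum ν) hsupp
    rw [← hFinv.eq_sum_orbitSum, Finsupp.filter_apply_pos _ _ (isPartition_rowPartition _ _), hrow,
      one_smul] at h
    exact h.symm
  · intro y hy
    rw [hF, macdonaldE_smul q _ hq0 _ _ y hy.1, macdonaldE_rowLaurent hq0 hq1 hk m y hy,
      Laurent.eval_smul _ _ y hy.1]
    ring

end

/-! ### Strict maximality of the row eigenvalue -/

noncomputable section

open Filter Topology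

section Eigenvalues

/-- The factor `r^(-x) + r^x s` of the eigenvalue, where `r² = q`. -/
def eigenFactor (r : ℝ) (x : ℤ) (s : ℝ) : ℝ := (r ^ x)⁻¹ + r ^ x * s

variable {r : ℝ}

theorem eigenFactor_pos (hr0 : 0 < r) (x : ℤ) {s : ℝ} (hs : 0 < s) : 0 < eigenFactor r x s := by
  have := zpow_pos hr0 x
  unfold eigenFactor
  positivity

/-- The difference factors as (r^x - r^m)(r^{-(m+x)} - s). Both factors are positive, the second
because m + x ≥ 0 and s < 1. -/
theorem eigenFactor_lt (hr0 : 0 < r) (hr1 : r < 1) {x m : ℤ} {s : ℝ} (hs1 : s < 1)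
    (hx : |x| ≤ m) (hne : x ≠ m) : eigenFactor r x s < eigenFactor r m s := by
  have hu := zpow_pos hr0 m
  have hv := zpow_pos hr0 x
  obtain ⟨h1, h2⟩ := abs_le.1 hx
  have hlt : r ^ m < r ^ x := zpow_lt_zpow_right_of_lt_one₀ hr0 hr1 (lt_of_le_of_ne h2 hne)
  have hprod : r ^ m * r ^ x ≤ 1 := by
    rw [← zpow_add₀ hr0.ne']
    exact zpow_le_one₀ hr0 hr1.le (by omega)
  have hinv : 1 ≤ (r ^ m * r ^ x)⁻¹ := (one_le_inv₀ (mul_pos hu hv)).2 hprod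
  have : eigenFactor r m s - eigenFactor r x s = (r ^ x - r ^ m) * ((r ^ m * r ^ x)⁻¹ - s) := by
    unfold eigenFactor
    field_simp
    ring
  have h3 : 0 < (r ^ x - r ^ m) * ((r ^ m * r ^ x)⁻¹ - s) :=
    mul_pos (sub_pos.2 hlt) (by linarith)
  linarith

theorem eigenFactor_le (hr0 : 0 < r) (hr1 : r < 1) {x m : ℤ} {s : ℝ} (hs1 : s < 1)
    (hx : |x| ≤ m) : eigenFactor r x s ≤ eigenFactor r m s := by
  by_cases h : x = m
  · rw [h]
  · exact (eigenFactor_lt hr0 hr1 hs1 hx h).le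

/-- With u = r^a and v = r^b the difference is (uv)⁻¹(1 - v²)(s' - u²s). Thus moving an exponent to
the slot with the smaller parameter increases the product. -/
theorem eigenFactor_mul_lt (hr0 : 0 < r) (hr1 : r < 1) {a b : ℤ} (ha : 0 ≤ a) (hb : 0 < b)
    {s s' : ℝ} (hs0 : 0 < s) (hs : s < s') :
    eigenFactor r a s * eigenFactor r b s' < eigenFactor r (a + b) s * eigenFactor r 0 s' := by
  have hu := zpow_pos hr0 a
  have hv := zpow_pos hr0 b
  have hu1 : r ^ a ≤ 1 := zpow_le_one₀ hr0 hr1.le ha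
  have hv1 : r ^ b < 1 := zpow_lt_one₀ hr0 hr1 hb
  unfold eigenFactor
  rw [zpow_add₀ hr0.ne', zpow_zero]
  generalize r ^ a = u at *
  generalize r ^ b = v at *
  have key : ((u * v)⁻¹ + u * v * s) * (1⁻¹ + 1 * s') - (u⁻¹ + u * s) * (v⁻¹ + v * s') =
      (u * v)⁻¹ * ((1 - v ^ 2) * (s' - u ^ 2 * s)) := by
    field_simp
    ring
  have h1 : 0 < 1 - v ^ 2 := by nlinarith
  have h2 : 0 < s' - u ^ 2 * s := by
    have : u ^ 2 ≤ 1 := pow_le_one₀ hu.le hu1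
    nlinarith
  have h3 : 0 < (u * v)⁻¹ * ((1 - v ^ 2) * (s' - u ^ 2 * s)) := by positivity
  linarith

/-- Collecting all exponents in one factor increases the product of the eigenvalue factors. -/
theorem eigenFactor_mul_prod {ι : Type*} (hr0 : 0 < r) (hr1 : r < 1) (b : ι → ℤ) (hb : ∀ i, 0 ≤ b i)
    {s : ℝ} (hs0 : 0 < s) (s' : ι → ℝ) (hs : ∀ i, s < s' i) (T : Finset ι) :
    ∀ a : ℤ, 0 ≤ a → (∀ i ∈ T, b i = 0) ∨ eigenFactor r a s * ∏ i ∈ T, eigenFactor r (b i) (s' i) <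
      eigenFactor r (a + ∑ i ∈ T, b i) s * ∏ i ∈ T, eigenFactor r 0 (s' i) := by
  classical
  induction T using Finset.induction_on with
  | empty => simp
  | insert j T hj ih =>
    intro a ha
    have hpos : ∀ x, ∀ i, 0 < eigenFactor r x (s' i) :=
      fun x i => eigenFactor_pos hr0 x (hs0.trans (hs i))
    rw [Finset.prod_insert hj, Finset.prod_insert hj, Finset.sum_insert hj, Finset.forall_mem_insert]
    rcases (hb j).eq_or_lt with hbj | hbj
    · rw [← hbj, zero_add]
      refine (ih a ha).imp (fun h => ⟨rfl, h⟩) fun h => ?_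
      have := mul_lt_mul_of_pos_left h (hpos 0 j)
      linarith
    · right
      have h1 : eigenFactor r (a + b j) s * ∏ i ∈ T, eigenFactor r (b i) (s' i) ≤
          eigenFactor r (a + b j + ∑ i ∈ T, b i) s * ∏ i ∈ T, eigenFactor r 0 (s' i) := by
        rcases ih (a + b j) (by linarith) with h | h
        · rw [Finset.sum_eq_zero h, add_zero, Finset.prod_congr rfl fun i hi => by rw [h i hi]]
        · exact h.le
      have h2 := mul_lt_mul_of_pos_right (eigenFactor_mul_lt hr0 hr1 ha hbj hs0 (hs j))
        (Finset.prod_pos (s := T) fun i _ => hpos (b i) i)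
      have h3 := mul_le_mul_of_nonneg_left h1 (hpos 0 j).le
      rw [← add_assoc]
      linarith

variable {n : ℕ}

theorem eigenvalueC_eq_prod {q : ℝ} (hq0 : 0 < q) (t : ℝ) (κ : Fin n → ℤ) :
    eigenvalueC q t κ = ∏ i : Fin n, eigenFactor (q ^ (1 / 2 : ℝ)) (κ i) (t ^ (n - (i : ℕ))) := by
  have h1 : ∀ x : ℤ, (q ^ (1 / 2 : ℝ)) ^ x = q ^ ((x : ℝ) / 2) := by
    intro x
    rw [← Real.rpow_intCast, ← Real.rpow_mul hq0.le]
    congr 1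
    ring
  have h2 : q ^ (-((∑ i, κ i : ℤ) : ℝ) / 2) = ∏ i, (q ^ ((κ i : ℝ) / 2))⁻¹ := by
    rw [Finset.prod_inv_distrib, ← Real.rpow_sum_of_pos hq0, ← Real.rpow_neg hq0.le]
    congr 1
    push_cast
    rw [← Finset.sum_div, neg_div]
  rw [eigenvalueC, h2, ← Finset.prod_mul_distrib]
  refine Finset.prod_congr rfl fun i _ => ?_
  have h3 : q ^ κ i = q ^ ((κ i : ℝ) / 2) * q ^ ((κ i : ℝ) / 2) := by
    rw [← Real.rpow_add hq0, add_halves, Real.rpow_intCast]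
  have h4 := Real.rpow_pos_of_pos hq0 ((κ i : ℝ) / 2)
  rw [eigenFactor, h1, h3]
  field_simp

/-- The eigenvalue of a row is larger than those of all other weights of no larger size. -/
theorem eigenvalueC_lt_rowPartition {q t : ℝ} (hq0 : 0 < q) (hq1 : q < 1) (ht0 : 0 < t) (ht1 : t < 1)
    {m : ℕ} {κ : Fin (n + 1) → ℤ} (hκ : ∑ i, |κ i| ≤ m) (hne : κ ≠ rowPartition (n + 1) m) :
    eigenvalueC q t κ < eigenvalueC q t (rowPartition (n + 1) m) := by
  have hr0 : 0 < q ^ (1 / 2 : ℝ) := Real.rpow_pos_of_pos hq0 _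
  have hr1 : q ^ (1 / 2 : ℝ) < 1 := Real.rpow_lt_one hq0.le hq1 (by norm_num)
  rw [eigenvalueC_eq_prod hq0, eigenvalueC_eq_prod hq0, Fin.prod_univ_succ, Fin.prod_univ_succ]
  set r := q ^ (1 / 2 : ℝ)
  set s : ℝ := t ^ (n + 1 - ((0 : Fin (n + 1)) : ℕ)) with hs
  set s' : Fin n → ℝ := fun i => t ^ (n + 1 - (i.succ : ℕ)) with hs'
  have hrow0 : rowPartition (n + 1) m 0 = m := by simp [rowPartition]
  have hrow : ∀ i : Fin n, rowPartition (n + 1) m i.succ = 0 := by simp [rowPartition]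
  have hs0 : 0 < s := pow_pos ht0 _
  have hs1 : s < 1 := pow_lt_one₀ ht0.le ht1 (by simp)
  have hs'0 : ∀ i, 0 < s' i := fun i => pow_pos ht0 _
  have hs'1 : ∀ i, s' i < 1 := fun i => pow_lt_one₀ ht0.le ht1 (by
    have := i.2
    simp only [Fin.val_succ]
    omega)
  have hss' : ∀ i, s < s' i := fun i => pow_lt_pow_right_of_lt_one₀ ht0 ht1 (by
    have := i.2
    simp only [Fin.val_succ, Fin.val_zero]
    omega)
  rw [hrow0]
  simp only [hrow]
  rw [Fin.sum_univ_succ] at hκ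
  have hsum0 : 0 ≤ ∑ i : Fin n, |κ i.succ| := Finset.sum_nonneg fun i _ => abs_nonneg _
  have hP0 : 0 < ∏ i, eigenFactor r 0 (s' i) := Finset.prod_pos fun i _ => eigenFactor_pos hr0 _ (hs'0 i)
  have h1 : ∏ i : Fin n, eigenFactor r (κ i.succ) (s' i) ≤ ∏ i : Fin n, eigenFactor r |κ i.succ| (s' i) :=
    Finset.prod_le_prod (fun i _ => (eigenFactor_pos hr0 _ (hs'0 i)).le)
      fun i _ => eigenFactor_le hr0 hr1 (hs'1 i) le_rfl
  -- Strictness has two sources: if all later coordinates vanish, the first differs from m;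
  -- otherwise collecting the exponents in the first slot is itself a strict increase.
  rcases eigenFactor_mul_prod hr0 hr1 (fun i : Fin n => |κ i.succ|) (fun i => abs_nonneg _) hs0 s' hss'
    Finset.univ |κ 0| (abs_nonneg _) with h | h
  · have hz : ∀ i : Fin n, κ i.succ = 0 := fun i => abs_eq_zero.1 (h i (Finset.mem_univ i))
    simp only [hz]
    refine mul_lt_mul_of_pos_right (eigenFactor_lt hr0 hr1 hs1 (by linarith) fun h0 => hne ?_) hP0
    ext i
    induction i using Fin.cases with
    | zero => rw [h0, hrow0]
    | succ i => rw [hz, hrow]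
  · calc _ ≤ eigenFactor r |κ 0| s * ∏ i : Fin n, eigenFactor r |κ i.succ| (s' i) :=
          mul_le_mul (eigenFactor_le hr0 hr1 hs1 le_rfl) h1
            (Finset.prod_nonneg fun i _ => (eigenFactor_pos hr0 _ (hs'0 i)).le)
            (eigenFactor_pos hr0 _ hs0).le
      _ < _ := h
      _ ≤ _ := mul_le_mul_of_nonneg_right (eigenFactor_le hr0 hr1 hs1 (by
          rw [abs_of_nonneg (by positivity)]
          exact hκ)) hP0.le

end Eigenvalues

/-! ### Asymptotics of E in a generic dominant direction -/

section LeadingTerm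

variable {n : ℕ}

/-- Strictly dominant weights that separate the points of a finite set. -/
theorem exists_dominant_injOn (S : Finset (Fin n → ℤ)) :
    ∃ w : Fin n → ℤ, StrictAnti w ∧ (∀ i, 0 < w i) ∧
      Set.InjOn (fun κ : Fin n → ℤ => ∑ i, w i * κ i) S := by
  classical
  -- The weights are w_i = B^{n-1-i}, so that the pairing with κ is the value at B of a polynomial
  -- with coefficients κ_i. A large natural B avoids the roots of the finitely many nonzero
  -- differences.
  set p : (Fin n → ℤ) → Polynomial ℝ := fun κ =>
    ∑ i : Fin n, Polynomial.monomial (n - 1 - (i : ℕ)) ((κ i : ℤ) : ℝ) with hp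
  have hp0 : ∀ κ, p κ = 0 → κ = 0 := by
    intro κ h
    ext j
    have := congrArg (fun f => f.coeff (n - 1 - (j : ℕ))) h
    simp only [hp, Polynomial.finsetSum_coeff, Polynomial.coeff_monomial, Polynomial.coeff_zero] at this
    rw [Finset.sum_eq_single j] at this
    · simpa using this
    · intro i _ hij
      rw [if_neg]
      intro h
      refine hij (Fin.ext ?_)
      have := i.2
      have := j.2
      omega
    · simp
  have hev : ∀ᶠ B : ℕ in atTop, ∀ κ ∈ (S ×ˢ S).image (fun x => x.1 - x.2), κ ≠ 0 →
      ¬ (p κ).IsRoot (B : ℝ) := by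
    rw [Filter.eventually_all_finset]
    intro κ _
    by_cases h : κ = 0
    · simp [h]
    · have := (tendsto_natCast_atTop_atTop (R := ℝ)).eventually
        (Polynomial.eventually_atTop_not_isRoot (p κ) fun h0 => h (hp0 κ h0))
      filter_upwards [this] with B hB _ using hB
  obtain ⟨B, hB, hB2⟩ := (hev.and (eventually_ge_atTop 2)).exists
  refine ⟨fun i => (B : ℤ) ^ (n - 1 - (i : ℕ)), ?_, ?_, ?_⟩
  · intro i j hij
    refine pow_lt_pow_right₀ (by exact_mod_cast hB2) ?_
    have : (i : ℕ) < j := hij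
    have := j.2
    omega
  · intro i
    have : (0 : ℤ) < B := by exact_mod_cast (by omega : 0 < B)
    positivity
  · intro κ hκ κ' hκ' h
    by_contra hne
    refine hB (κ - κ') (Finset.mem_image.2 ⟨(κ, κ'), Finset.mem_product.2 ⟨hκ, hκ'⟩, rfl⟩)
      (sub_ne_zero.2 hne) ?_
    have h' : ((∑ i : Fin n, (B : ℤ) ^ (n - 1 - (i : ℕ)) * κ i : ℤ) : ℝ) =
        ((∑ i : Fin n, (B : ℤ) ^ (n - 1 - (i : ℕ)) * κ' i : ℤ) : ℝ) := congrArg _ h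
    simp only [hp, Polynomial.IsRoot, Polynomial.eval_finsetSum, Polynomial.eval_monomial, Pi.sub_apply]
    push_cast at h' ⊢
    simp only [sub_mul, Finset.sum_sub_distrib]
    rw [sub_eq_zero]
    simpa only [mul_comm] using h'

theorem tendsto_ofReal_zpow_zero {e : ℤ} (he : e < 0) :
    Tendsto (fun τ : ℝ => (τ : ℂ) ^ e) atTop (𝓝 0) := by
  have h : Tendsto (fun τ : ℝ => τ ^ e) atTop (𝓝 0) := tendsto_zpow_atTop_zero he
  have := (Complex.continuous_ofReal.tendsto 0).comp h
  simpa [Function.comp_def] using this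

theorem tendsto_shift_factor (t : ℂ) {e : ℤ} (he : e ≠ 0) :
    Tendsto (fun τ : ℝ => (1 - t * (τ : ℂ) ^ e) / (1 - (τ : ℂ) ^ e)) atTop
      (𝓝 (if 0 < e then t else 1)) := by
  rcases lt_or_gt_of_ne he with h | h
  · rw [if_neg h.not_gt]
    have h0 := tendsto_ofReal_zpow_zero h
    have := ((tendsto_const_nhds (x := (1 : ℂ))).sub (h0.const_mul t)).div
      ((tendsto_const_nhds (x := (1 : ℂ))).sub h0)
      (by simp)
    rw [mul_zero, sub_zero, div_one] at this
    exact this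
  · rw [if_pos h]
    have h0 := tendsto_ofReal_zpow_zero (neg_lt_zero.2 h)
    have := (h0.sub (tendsto_const_nhds (x := t))).div (h0.sub (tendsto_const_nhds (x := (1 : ℂ))))
      (by simp)
    simp only [zero_sub, neg_div_neg_eq, div_one] at this
    refine this.congr' ?_
    filter_upwards [eventually_gt_atTop 0] with τ hτ
    have hτ' : (τ : ℂ) ^ e ≠ 0 := zpow_ne_zero _ (Complex.ofReal_ne_zero.2 hτ.ne')
    simp only [Pi.div_apply]
    rw [zpow_neg, ← mul_div_mul_right _ _ hτ', sub_mul, sub_mul, inv_mul_cancel₀ hτ', one_mul]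

/-- The larger weight decides the sign, so the limit of a pair factor of `E` depends only on the
sign of the smaller index. -/
theorem units_mul_add_pos {u v : ℤ} (hv : 0 < v) (huv : v < u) (a b : ℤˣ) :
    ((a : ℤ) * u + (b : ℤ) * v ≠ 0) ∧ (0 < (a : ℤ) * u + (b : ℤ) * v ↔ a = 1) := by
  rcases Int.units_eq_one_or a with rfl | rfl <;> rcases Int.units_eq_one_or b with rfl | rfl <;>
    simp <;> omega

theorem ofReal_zpow_ne_one {τ : ℝ} (hτ : 1 < τ) {e : ℤ} (he : e ≠ 0) : (τ : ℂ) ^ e ≠ 1 := by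
  rw [← Complex.ofReal_zpow]
  norm_cast
  rwa [zpow_eq_one_iff_right₀ (zero_le_one.trans hτ.le) hτ.ne']

/-- The leading exponent of an eigenfunction of `E` determines the eigenvalue. -/
theorem exists_eigenvalueC_eq {q : ℝ} (hq0 : 0 < q) (t : ℝ) (D : Laurent n) (hD : D ≠ 0) (c : ℂ)
    (hE : ∀ y, IsRegularPoint y → macdonaldE q t D.eval y = c * D.eval y) :
    ∃ κ ∈ D.coeff.support, (eigenvalueC q t κ : ℂ) = c := by
  obtain ⟨w, hanti, hpos, hinj⟩ := exists_dominant_injOn D.coeff.support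
  have hne : D.coeff.support.Nonempty := by
    rw [Finsupp.support_nonempty_iff]
    exact fun h => hD (AddMonoidAlgebra.coeff_eq_zero.1 h)
  obtain ⟨κ, hκ, hmax⟩ := D.coeff.support.exists_max_image (fun κ => ∑ i, w i * κ i) hne
  refine ⟨κ, hκ, ?_⟩
  -- Along this curve, as τ → ∞, the separating weights single out κ as the unique leading exponent
  -- of `D`.
  set y : ℝ → Fin n → ℂ := fun τ i => (τ : ℂ) ^ w i with hy
  set r : ℝ := q ^ (1 / 2 : ℝ) with hr
  have hreg : ∀ τ : ℝ, 1 < τ → IsRegularPoint (y τ) := by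
    intro τ hτ
    have hτ0 : (τ : ℂ) ≠ 0 := Complex.ofReal_ne_zero.2 (by linarith)
    refine ⟨fun i => zpow_ne_zero _ hτ0, fun i j hij a b => ?_, fun i a => ?_⟩
    · simp only [hy]
      rw [← zpow_mul, ← zpow_mul, ← zpow_add₀ hτ0, mul_comm (w i), mul_comm (w j)]
      exact sub_ne_zero.2 (ofReal_zpow_ne_one hτ (units_mul_add_pos (hpos j) (hanti hij) a b).1).symm
    · simp only [hy]
      rw [← zpow_mul]
      refine sub_ne_zero.2 (ofReal_zpow_ne_one hτ ?_).symm
      exact mul_ne_zero (hpos i).ne' (mul_ne_zero two_ne_zero a.ne_zero)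
  set L : ℤˣ → ℂ := fun s => if s = 1 then (t : ℂ) else 1 with hL
  have hcoef : ∀ a : Fin n → ℤˣ, Tendsto (fun τ => shiftCoeff t (signPow (y τ) a)) atTop
      (𝓝 (∏ i : Fin n, L (a i) ^ (n - (i : ℕ)))) := by
    intro a
    -- The exponent n - i counts the n - 1 - i pairs i < j together with the long-root factor at i.
    have hlim : ∏ i : Fin n, L (a i) ^ (n - (i : ℕ)) =
        (∏ i : Fin n, ∏ j ∈ Finset.Ioi i, L (a i)) * ∏ i, L (a i) := by
      rw [← Finset.prod_mul_distrib]
      refine Finset.prod_congr rfl fun i _ => ?_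
      rw [Finset.prod_const, Fin.card_Ioi, ← pow_succ]
      congr 1
      have := i.2
      omega
    rw [hlim]
    refine Tendsto.mul (tendsto_finsetProd _ fun i _ => tendsto_finsetProd _ fun j hj => ?_)
      (tendsto_finsetProd _ fun i _ => ?_)
    · have hij : i < j := Finset.mem_Ioi.1 hj
      obtain ⟨h1, h2⟩ := units_mul_add_pos (hpos j) (hanti hij) (a i) (a j)
      have := tendsto_shift_factor t h1
      simp only [h2] at this
      refine this.congr' ?_
      filter_upwards [eventually_gt_atTop 0] with τ hτ
      have hτ0 : (τ : ℂ) ≠ 0 := Complex.ofReal_ne_zero.2 hτ.ne'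
      simp only [signPow, hy]
      rw [← zpow_mul, ← zpow_mul, ← zpow_add₀ hτ0, mul_comm (w i), mul_comm (w j)]
    · have h1 : (a i : ℤ) * w i + (a i : ℤ) * w i ≠ 0 := by
        rw [← two_mul]
        exact mul_ne_zero two_ne_zero (mul_ne_zero (a i).ne_zero (hpos i).ne')
      have h2 : 0 < (a i : ℤ) * w i + (a i : ℤ) * w i ↔ a i = 1 := by
        have := hpos i
        rcases Int.units_eq_one_or (a i) with h | h <;> rw [h] <;> simp <;> omega
      have := tendsto_shift_factor t h1
      simp only [h2] at this
      refine this.congr' ?_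
      filter_upwards [eventually_gt_atTop 0] with τ hτ
      have hτ0 : (τ : ℂ) ≠ 0 := Complex.ofReal_ne_zero.2 hτ.ne'
      simp only [signPow, hy]
      rw [← zpow_mul, zpow_add₀ hτ0, mul_comm (w i), pow_two]
  set M := ∑ i, w i * κ i with hM
  have hscaled : ∀ g : Fin n → ℂ, (∀ i, g i ≠ 0) → Tendsto
      (fun τ : ℝ => D.eval (fun i => g i * y τ i) * (τ : ℂ) ^ (-M)) atTop
      (𝓝 (D.coeff κ * ∏ i, g i ^ κ i)) := by
    intro g hg
    have hsum : Tendsto (fun τ : ℝ => ∑ ν ∈ D.coeff.support,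
        (D.coeff ν * ∏ i, g i ^ ν i) * (τ : ℂ) ^ (∑ i, w i * ν i - M)) atTop
        (𝓝 (∑ ν ∈ D.coeff.support, if ν = κ then D.coeff κ * ∏ i, g i ^ κ i else 0)) := by
      refine tendsto_finsetSum _ fun ν hν => ?_
      by_cases h : ν = κ
      · subst h
        simp [hM]
      · rw [if_neg h]
        have hlt : ∑ i, w i * ν i - M < 0 :=
          sub_neg.2 (lt_of_le_of_ne (hmax ν hν) fun h' => h (hinj hν hκ h'))
        simpa using (tendsto_ofReal_zpow_zero hlt).const_mul (D.coeff ν * ∏ i, g i ^ ν i)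
    rw [Finset.sum_ite_eq' _ _ _, if_pos hκ] at hsum
    refine hsum.congr' ?_
    filter_upwards [eventually_gt_atTop 0] with τ hτ
    have hτ0 : (τ : ℂ) ≠ 0 := Complex.ofReal_ne_zero.2 hτ.ne'
    rw [Laurent.eval, Finsupp.sum, Finset.sum_mul]
    refine Finset.sum_congr rfl fun ν _ => ?_
    have : ∏ i, (g i * y τ i) ^ ν i = (∏ i, g i ^ ν i) * (τ : ℂ) ^ (∑ i, w i * ν i) := by
      rw [← Finset.prod_congr rfl fun i _ => (mul_zpow (g i) (y τ i) (ν i)).symm,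
        Finset.prod_mul_distrib]
      congr 1
      simp only [hy, ← zpow_mul]
      induction (Finset.univ : Finset (Fin n)) using Finset.induction_on with
      | empty => simp
      | insert i s hi ih => rw [Finset.prod_insert hi, Finset.sum_insert hi, zpow_add₀ hτ0, ih]
    rw [this, zpow_sub₀ hτ0, zpow_neg]
    ring
  have hleft : Tendsto (fun τ : ℝ => macdonaldE q t D.eval (y τ) * (τ : ℂ) ^ (-M)) atTop
      (𝓝 (∑ a : Fin n → ℤˣ, (∏ i : Fin n, L (a i) ^ (n - (i : ℕ))) *
        (D.coeff κ * ∏ i, ((r : ℂ) ^ (a i : ℤ)) ^ κ i))) := by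
    simp only [macdonaldE_eq, Finset.sum_mul, mul_assoc]
    refine tendsto_finsetSum _ fun a _ => (hcoef a).mul ?_
    have hr0 : (r : ℂ) ≠ 0 := Complex.ofReal_ne_zero.2 (Real.rpow_pos_of_pos hq0 _).ne'
    have := hscaled (fun i => (r : ℂ) ^ (a i : ℤ)) fun i => zpow_ne_zero _ hr0
    refine this.congr fun τ => ?_
    congr 2
    ext i
    rw [halfShift, sqrt_zpow_units hq0]
  have hright : Tendsto (fun τ : ℝ => macdonaldE q t D.eval (y τ) * (τ : ℂ) ^ (-M)) atTop
      (𝓝 (c * D.coeff κ)) := by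
    have := (hscaled (fun _ => 1) fun _ => one_ne_zero).const_mul c
    simp only [one_mul, one_zpow, Finset.prod_const_one, mul_one] at this
    refine this.congr' ?_
    filter_upwards [eventually_gt_atTop 1] with τ hτ
    rw [hE _ (hreg τ hτ), mul_assoc]
  have heq := tendsto_nhds_unique hleft hright
  -- The limiting sum over sign vectors factors into one two-term sum per coordinate, which is the
  -- eigenvalue factor.
  have hval : ∑ a : Fin n → ℤˣ, (∏ i : Fin n, L (a i) ^ (n - (i : ℕ))) *
        (D.coeff κ * ∏ i, ((r : ℂ) ^ (a i : ℤ)) ^ κ i) = eigenvalueC q t κ * D.coeff κ := by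
    rw [eigenvalueC_eq_prod hq0]
    have h1 : ∀ i : Fin n, ((eigenFactor r (κ i) (t ^ (n - (i : ℕ))) : ℝ) : ℂ) =
        ∑ s : ℤˣ, L s ^ (n - (i : ℕ)) * ((r : ℂ) ^ (s : ℤ)) ^ κ i := by
      intro i
      rw [show (Finset.univ : Finset ℤˣ) = {1, -1} from rfl, Finset.sum_pair (by decide)]
      simp [hL, eigenFactor]
      ring
    rw [Complex.ofReal_prod]
    simp only [← hr, h1]
    rw [Finset.prod_univ_sum, Fintype.piFinset_univ, Finset.sum_mul]
    refine Finset.sum_congr rfl fun a _ => ?_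
    rw [Finset.prod_mul_distrib]
    ring
  rw [hval] at heq
  exact mul_right_cancel₀ (Finsupp.mem_support_iff.1 hκ) heq

end LeadingTerm

/-! ### Uniqueness of the Macdonald polynomial of a row -/

section Uniqueness

variable {n : ℕ}

/-- A partition in the orbit of a row is that row. -/
theorem IsPartition.eq_rowPartition {ν : Fin (n + 1) → ℤ} {m : ℕ} (hν : IsPartition ν)
    (h : rowPartition (n + 1) m ∈ weylOrbit ν) : ν = rowPartition (n + 1) m :=
  hν.eq_of_mem_weylOrbit (isPartition_rowPartition _ _) h (mem_weylOrbit_self _)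

theorem sum_abs_of_mem_weylOrbit {ν κ : Fin n → ℤ} (hν : IsPartition ν) (h : κ ∈ weylOrbit ν) :
    ∑ i, |κ i| = ∑ i, ν i := by
  obtain ⟨a, σ, rfl⟩ := mem_weylOrbit.1 h
  simp only [abs_units_mul, abs_of_nonneg (hν.2 _)]
  exact Equiv.sum_comp σ ν

theorem coeff_sum_orbitSum_ne_zero {a : (Fin n → ℤ) →₀ ℂ} {κ : Fin n → ℤ}
    (h : (a.sum fun ν c => c • orbitSum ν).coeff κ ≠ 0) : ∃ ν ∈ a.support, κ ∈ weylOrbit ν := by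
  rw [Finsupp.sum, AddMonoidAlgebra.coeff_sum, Finset.sum_apply'] at h
  obtain ⟨ν, hν, hne⟩ := Finset.exists_ne_zero_of_sum_ne_zero h
  refine ⟨ν, hν, ?_⟩
  by_contra hκ
  simp [coeff_orbitSum, hκ] at hne

/-- Uniqueness of the Macdonald polynomial of a row. -/
theorem IsMacdonald.unique_of_row {q t : ℝ} (hq0 : 0 < q) (hq1 : q < 1) (ht0 : 0 < t) (ht1 : t < 1)
    {m : ℕ} {P P' : Laurent (n + 1)} (hP : IsMacdonald q t (rowPartition (n + 1) m) P)
    (hP' : IsMacdonald q t (rowPartition (n + 1) m) P') : P' = P := by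
  obtain ⟨⟨a, ha, rfl⟩, hE⟩ := hP
  obtain ⟨⟨a', ha', rfl⟩, hE'⟩ := hP'
  rw [← sub_eq_zero]
  by_contra hne
  obtain ⟨κ, hκ, heq⟩ := exists_eigenvalueC_eq hq0 t _ hne
    (eigenvalueC q t (rowPartition (n + 1) m) : ℂ) (by
      intro y hy
      rw [← Laurent.evalHom_apply y hy.1, map_sub, mul_sub, Laurent.evalHom_apply,
        Laurent.evalHom_apply, ← hE y hy, ← hE' y hy]
      simp only [macdonaldE_eq, ← Finset.sum_sub_distrib, ← mul_sub]
      refine Finset.sum_congr rfl fun s _ => ?_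
      have hs := halfShift_ne_zero hq0 s hy.1
      rw [← Laurent.evalHom_apply _ hs, ← Laurent.evalHom_apply _ hs, ← Laurent.evalHom_apply _ hs,
        ← map_sub])
  rw [add_sub_add_left_eq_sub, Finsupp.mem_support_iff, AddMonoidAlgebra.coeff_sub,
    Finsupp.sub_apply] at hκ
  obtain ⟨ν, ⟨hν, hdom⟩, hmem⟩ : ∃ ν, (IsPartition ν ∧ DominatedBy ν (rowPartition (n + 1) m)) ∧
      κ ∈ weylOrbit ν := by
    by_cases h : (a.sum fun ν c => c • orbitSum ν).coeff κ = 0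
    · rw [h, sub_zero] at hκ
      obtain ⟨ν, hν, h⟩ := coeff_sum_orbitSum_ne_zero hκ
      exact ⟨ν, ha' ν hν, h⟩
    · obtain ⟨ν, hν, h⟩ := coeff_sum_orbitSum_ne_zero h
      exact ⟨ν, ha ν hν, h⟩
  -- The leading exponent κ is not known to be a partition, so the inequality is needed for
  -- arbitrary weights of bounded size.
  have hlt := eigenvalueC_lt_rowPartition hq0 hq1 ht0 ht1 (κ := κ) (m := m)
    (by rw [sum_abs_of_mem_weylOrbit hν hmem, ← sum_rowPartition n m]; exact hdom.sum_le)
    (by rintro rfl; exact hdom.1 (hν.eq_rowPartition hmem))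
  exact hlt.ne (Complex.ofReal_injective heq)

end Uniqueness

end

/-! ### Circle integrals as power series coefficients -/

noncomputable section

open Filter Topology

section CircleIntegral

variable {ι : Type*} (p : ι → ℂ) (R : ℝ)

/-- The `m`-th coefficient at infinity of `∏ i ∈ s, 1 / (1 - p_i / x)`, as an integral. -/
def circleCoeff (m : ℤ) (s : Finset ι) : ℂ :=
  (2 * π * Complex.I)⁻¹ * ∮ x in C(0, R), x ^ (m - 1) * ∏ i ∈ s, (1 - p i / x)⁻¹

variable {p R}

theorem ne_zero_of_mem_sphere_zero {x : ℂ} (hR : 0 < R) (hx : x ∈ Metric.sphere (0 : ℂ) R) : x ≠ 0 := by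
  rintro rfl
  simp at hx
  exact hR.ne hx

theorem one_sub_div_ne_zero {x a : ℂ} (hR : 0 < R) (ha : ‖a‖ < R)
    (hx : x ∈ Metric.sphere (0 : ℂ) R) : 1 - a / x ≠ 0 := by
  have hx0 := ne_zero_of_mem_sphere_zero hR hx
  intro h
  rw [sub_eq_zero, eq_div_iff hx0, one_mul] at h
  rw [mem_sphere_zero_iff_norm] at hx
  rw [← h, hx] at ha
  exact lt_irrefl _ ha

theorem continuousOn_prod_inv (hR : 0 < R) (hp : ∀ i, ‖p i‖ < R) (s : Finset ι) :
    ContinuousOn (fun x => ∏ i ∈ s, (1 - p i / x)⁻¹) (Metric.sphere (0 : ℂ) R) :=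
  continuousOn_finsetProd _ fun i _ => ContinuousOn.inv₀
    (continuousOn_const.sub (continuousOn_const.div continuousOn_id
      fun _ hx => ne_zero_of_mem_sphere_zero hR hx)) fun _ hx => one_sub_div_ne_zero hR (hp i) hx

theorem circleIntegrable_zpow_mul_prod (hR : 0 < R) (hp : ∀ i, ‖p i‖ < R) (m : ℤ) (s : Finset ι) :
    CircleIntegrable (fun x => x ^ m * ∏ i ∈ s, (1 - p i / x)⁻¹) 0 R := by
  refine ContinuousOn.circleIntegrable hR.le (ContinuousOn.mul ?_ (continuousOn_prod_inv hR hp s))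
  exact continuousOn_id.zpow₀ m fun _ hx => Or.inl (ne_zero_of_mem_sphere_zero hR hx)

/-- From (1 - p/x)⁻¹ = 1 + (p/x)(1 - p/x)⁻¹; series coefficients obey the same recursion. -/
theorem circleCoeff_insert [DecidableEq ι] (hR : 0 < R) (hp : ∀ i, ‖p i‖ < R) (m : ℤ)
    {s : Finset ι} {i : ι} (hi : i ∉ s) :
    circleCoeff p R m (insert i s) =
      circleCoeff p R m s + p i * circleCoeff p R (m - 1) (insert i s) := by
  have h : (∮ x in C(0, R), x ^ (m - 1) * ∏ j ∈ insert i s, (1 - p j / x)⁻¹) =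
      (∮ x in C(0, R), x ^ (m - 1) * ∏ j ∈ s, (1 - p j / x)⁻¹) +
        p i * ∮ x in C(0, R), x ^ (m - 1 - 1) * ∏ j ∈ insert i s, (1 - p j / x)⁻¹ := by
    rw [← circleIntegral.integral_const_mul, ← circleIntegral.integral_add
      (circleIntegrable_zpow_mul_prod hR hp _ _)
      (by
        have := (circleIntegrable_zpow_mul_prod hR hp (m - 1 - 1) (insert i s)).const_fun_smul (a := p i)
        simpa only [smul_eq_mul] using this)]
    refine circleIntegral.integral_congr hR.le fun x hx => ?_
    have hx0 := ne_zero_of_mem_sphere_zero hR hx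
    have h1 := one_sub_div_ne_zero hR (hp i) hx
    simp only [Finset.prod_insert hi]
    have h2 : x ^ (m - 1) = x ^ (m - 1 - 1) * x := by
      rw [← zpow_add_one₀ hx0, sub_add_cancel]
    have h3 : (1 - p i / x)⁻¹ * x = x + p i * (1 - p i / x)⁻¹ := by
      rw [← mul_right_inj' h1, ← mul_assoc, mul_inv_cancel₀ h1, mul_add, mul_left_comm _ (p i),
        mul_inv_cancel₀ h1]
      field_simp
      ring
    rw [h2]
    linear_combination x ^ (m - 1 - 1) * (∏ j ∈ s, (1 - p j / x)⁻¹) * h3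
  rw [circleCoeff, h, circleCoeff, circleCoeff]
  ring

theorem circleCoeff_empty (hR : 0 < R) (m : ℤ) :
    circleCoeff p R m ∅ = if m = 0 then 1 else 0 := by
  simp only [circleCoeff, Finset.prod_empty, mul_one]
  split_ifs with h
  · subst h
    have := circleIntegral.integral_sub_center_inv (0 : ℂ) hR.ne'
    simp only [sub_zero] at this
    simp only [zero_sub, zpow_neg_one, this]
    exact inv_mul_cancel₀ Complex.two_pi_I_ne_zero
  · have := circleIntegral.integral_sub_zpow_of_ne (n := m - 1) (by omega) 0 0 R
    simp only [sub_zero] at this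
    rw [this, mul_zero]

/-- For m < 0 the recursion loses its first term, and N iterations give p_i^N times the coefficient
of index m - N. This is bounded by a constant times (‖p_i‖/R)^N, which tends to 0. -/
theorem circleCoeff_eq_zero_of_neg (hR : 0 < R) (hp : ∀ i, ‖p i‖ < R) (s : Finset ι) :
    ∀ m : ℤ, m < 0 → circleCoeff p R m s = 0 := by
  classical
  induction s using Finset.induction_on with
  | empty =>
    intro m hm
    rw [circleCoeff_empty hR, if_neg hm.ne]
  | insert i s hi ih =>
    intro m hm
    obtain ⟨M, hM⟩ := (isCompact_sphere (0 : ℂ) R).exists_bound_of_continuousOn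
      (continuousOn_prod_inv hR hp (insert i s))
    have hiter : ∀ N : ℕ, circleCoeff p R m (insert i s) =
        p i ^ N * circleCoeff p R (m - N) (insert i s) := by
      intro N
      induction N with
      | zero => simp
      | succ N ihN =>
        rw [ihN, circleCoeff_insert hR hp _ hi, ih _ (by omega)]
        push_cast
        rw [sub_sub]
        ring
    have hbound : ∀ l : ℤ, ‖circleCoeff p R l (insert i s)‖ ≤ R ^ l * M := by
      intro l
      have := circleIntegral.norm_two_pi_i_inv_smul_integral_le_of_norm_le_const hR.le
        (f := fun x => x ^ (l - 1) * ∏ j ∈ insert i s, (1 - p j / x)⁻¹) (c := 0)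
        (C := R ^ (l - 1) * M) (fun x hx => by
          rw [norm_mul, norm_zpow, mem_sphere_zero_iff_norm.1 hx]
          exact mul_le_mul_of_nonneg_left (hM x hx) (zpow_nonneg hR.le _))
      rwa [smul_eq_mul, ← mul_assoc, ← zpow_one_add₀ hR.ne', add_sub_cancel] at this
    have hlim : Tendsto (fun N : ℕ => R ^ m * M * (‖p i‖ / R) ^ N) atTop (𝓝 (R ^ m * M * 0)) :=
      (tendsto_pow_atTop_nhds_zero_of_lt_one (by positivity) ((div_lt_one hR).2 (hp i))).const_mul _
    rw [mul_zero] at hlim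
    refine norm_le_zero_iff.1 (ge_of_tendsto' hlim fun N => ?_)
    rw [hiter N, norm_mul, norm_pow]
    refine (mul_le_mul_of_nonneg_left (hbound _) (by positivity)).trans_eq ?_
    rw [zpow_sub₀ hR.ne', zpow_natCast, div_pow]
    ring

open PowerSeries in
/-- The integral gives the coefficients of the power series `∏ i ∈ s, 1 / (1 - p_i X)`. -/
theorem circleCoeff_eq_coeff (hR : 0 < R) (hp : ∀ i, ‖p i‖ < R) (s : Finset ι) :
    ∀ S : ℂ⟦X⟧, S * ∏ i ∈ s, (1 - C (p i) * X) = 1 → ∀ m : ℕ,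
      circleCoeff p R m s = coeff m S := by
  classical
  induction s using Finset.induction_on with
  | empty =>
    intro S hS m
    rw [Finset.prod_empty, mul_one] at hS
    rw [circleCoeff_empty hR, hS, coeff_one]
    simp
  | insert i s hi ih =>
    intro S hS m
    rw [Finset.prod_insert hi, ← mul_assoc] at hS
    have ih := ih _ hS
    induction m with
    | zero =>
      rw [circleCoeff_insert hR hp _ hi, ih, circleCoeff_eq_zero_of_neg hR hp _ _ (by simp)]
      simp
    | succ m ihm =>
      rw [circleCoeff_insert hR hp _ hi, ih]
      have : ((m + 1 : ℕ) : ℤ) - 1 = m := by push_cast; ring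
      rw [this, ihm, mul_sub, mul_one, map_sub, mul_left_comm, coeff_C_mul, coeff_succ_mul_X]
      ring

end CircleIntegral

/-! ### The form Φ on the circle -/

section Integrand

variable {n : ℕ}

theorem phi_eq_prod_poles (q : ℝ) (k lam : ℕ) (y : Fin n → ℂ) (x : ℂ) :
    phi q k lam y x = x ^ lam * (∏ p ∈ (Finset.univ : Finset (Fin n × ℤˣ)) ×ˢ Finset.range k,
      (1 - pole q y p.1.1 p.1.2 p.2 / x)⁻¹) / x := by
  rw [phi, Finset.prod_product, Fintype.prod_prod_type]
  congr 2
  refine Finset.prod_congr rfl fun i _ => ?_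
  rw [show (Finset.univ : Finset ℤˣ) = {1, -1} from rfl, Finset.prod_pair (by decide), one_div,
    mul_inv, qPoch, qPoch, Finset.prod_inv_distrib, Finset.prod_inv_distrib]
  simp only [pole, Units.val_one, zpow_one, Units.val_neg, zpow_neg, div_mul_eq_mul_div]

theorem circleIntegral_phi (q : ℝ) (k lam : ℕ) (y : Fin n → ℂ)
    {R : ℝ} (hR : 0 < R) (hp : ∀ p ∈ poles q k y, ‖p‖ < R) (S : PowerSeries ℂ)
    (hS : S * ∏ p ∈ (Finset.univ : Finset (Fin n × ℤˣ)) ×ˢ Finset.range k,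
      (1 - PowerSeries.C (pole q y p.1.1 p.1.2 p.2) * PowerSeries.X) = 1) :
    (2 * π * Complex.I)⁻¹ * (∮ x in C(0, R), phi q k lam y x) = PowerSeries.coeff lam S := by
  set T := (Finset.univ : Finset (Fin n × ℤˣ)) ×ˢ Finset.range k
  -- The index type is cut down to `T` because the norm bound is available only for l < k.
  have hp' : ∀ p : T, ‖pole q y p.1.1.1 p.1.1.2 p.1.2‖ < R := by
    rintro ⟨⟨⟨i, s⟩, l⟩, h⟩
    have hl : l < k := Finset.mem_range.1 (Finset.mem_product.1 h).2
    exact hp _ ⟨i, s, l, hl, rfl⟩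
  rw [← Finset.prod_attach] at hS
  rw [← circleCoeff_eq_coeff hR hp' _ _ hS, circleCoeff]
  congr 1
  refine circleIntegral.integral_congr hR.le fun x hx => ?_
  have hx0 := ne_zero_of_mem_sphere_zero hR hx
  simp only [phi_eq_prod_poles]
  rw [← Finset.prod_attach, zpow_sub_one₀ hx0, zpow_natCast]
  ring

end Integrand

end

/-! ### Integration along piecewise smooth closed paths -/

noncomputable section

open Filter Topology

section Paths

/-- At a break point `deriv` need not agree with the one-sided derivative, which is the continuous
one. The two agree on the open interval, and the endpoints are negligible. -/
theorem intervalIntegrable_deriv_mul_comp {γ : ℝ → ℂ} {u v : ℝ} (huv : u < v)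
    (hγ : ContDiffOn ℝ 1 γ (Set.Icc u v)) {f : ℂ → ℂ} {K : Set ℂ} (hK : Set.MapsTo γ (Set.Icc u v) K)
    (hf : ContinuousOn f K) : IntervalIntegrable (fun s => deriv γ s * f (γ s)) MeasureTheory.volume u v := by
  have h1 : ContinuousOn (fun s => derivWithin γ (Set.Icc u v) s * f (γ s)) (Set.Icc u v) :=
    (hγ.continuousOn_derivWithin (uniqueDiffOn_Icc huv) le_rfl).mul (hf.comp hγ.continuousOn hK)
  have h2 : IntervalIntegrable (fun s => derivWithin γ (Set.Icc u v) s * f (γ s))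
      MeasureTheory.volume u v := ContinuousOn.intervalIntegrable_of_Icc huv.le h1
  rw [intervalIntegrable_iff_integrableOn_Ioo_of_le huv.le] at h2 ⊢
  refine h2.congr_fun (fun s hs => ?_) measurableSet_Ioo
  simp only [derivWithin_of_mem_nhds (Icc_mem_nhds hs.1 hs.2)]

variable (γ : ClosedPath)

theorem ClosedPath.intervalIntegrable {f : ℂ → ℂ} (hf : ContinuousOn f γ.trace) :
    IntervalIntegrable (fun s => deriv γ.toFun s * f (γ.toFun s)) MeasureTheory.volume γ.a γ.b := by
  obtain ⟨m, p, hp, h0, h1, hd⟩ := γ.piecewise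
  have hsub : ∀ i : Fin m, Set.MapsTo γ.toFun (Set.Icc (p i.castSucc) (p i.succ)) γ.trace := by
    intro i s hs
    refine ⟨s, ⟨?_, ?_⟩, rfl⟩
    · rw [← h0]
      exact (hp.monotone (Fin.zero_le _)).trans hs.1
    · rw [← h1]
      exact hs.2.trans (hp.monotone (Fin.le_last _))
  have key : ∀ i : Fin (m + 1), IntervalIntegrable (fun s => deriv γ.toFun s * f (γ.toFun s))
      MeasureTheory.volume (p 0) (p i) := by
    intro i
    induction i using Fin.induction with
    | zero => simp
    | succ i ih => exact ih.trans (intervalIntegrable_deriv_mul_comp (hp i.castSucc_lt_succ) (hd i) (hsub i) hf)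
  rw [← h0, ← h1]
  exact key _

/-- The integral of a function with a primitive over a closed path vanishes. -/
theorem ClosedPath.integral_eq_zero {f F : ℂ → ℂ} (hf : ContinuousOn f γ.trace)
    (hF : ∀ x ∈ γ.trace, HasDerivAt F (f x) x) : γ.integral f = 0 := by
  obtain ⟨m, p, hp, h0, h1, hd⟩ := γ.piecewise
  have hsub : ∀ i : Fin m, Set.MapsTo γ.toFun (Set.Icc (p i.castSucc) (p i.succ)) γ.trace := by
    intro i s hs
    refine ⟨s, ⟨?_, ?_⟩, rfl⟩
    · rw [← h0]
      exact (hp.monotone (Fin.zero_le _)).trans hs.1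
    · rw [← h1]
      exact hs.2.trans (hp.monotone (Fin.le_last _))
  have hint := fun i : Fin m => intervalIntegrable_deriv_mul_comp (hp i.castSucc_lt_succ) (hd i) (hsub i) hf
  have hpiece : ∀ i : Fin m, ∫ s in p i.castSucc..p i.succ, deriv γ.toFun s * f (γ.toFun s) =
      F (γ.toFun (p i.succ)) - F (γ.toFun (p i.castSucc)) := by
    intro i
    have hlt := hp i.castSucc_lt_succ
    refine intervalIntegral.integral_eq_sub_of_hasDerivAt_of_le hlt.le
      (f := fun s => F (γ.toFun s)) ?_ ?_ (hint i)
    · intro s hs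
      exact (hF _ (hsub i hs)).continuousAt.comp_continuousWithinAt ((hd i).continuousOn s hs)
    · intro s hs
      have hs' : DifferentiableAt ℝ γ.toFun s :=
        ((hd i).differentiableOn one_ne_zero).differentiableAt (Icc_mem_nhds hs.1 hs.2)
      exact HasDerivAt.scomp s (hF _ (hsub i (Set.Ioo_subset_Icc_self hs))) hs'.hasDerivAt
  have key : ∀ i : Fin (m + 1), IntervalIntegrable (fun s => deriv γ.toFun s * f (γ.toFun s))
      MeasureTheory.volume (p 0) (p i) ∧ ∫ s in p 0..p i, deriv γ.toFun s * f (γ.toFun s) =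
      F (γ.toFun (p i)) - F (γ.toFun (p 0)) := by
    intro i
    induction i using Fin.induction with
    | zero => simp
    | succ i ih =>
      refine ⟨ih.1.trans (hint i), ?_⟩
      rw [← intervalIntegral.integral_add_adjacent_intervals ih.1 (hint i), ih.2, hpiece]
      ring
  rw [ClosedPath.integral, ← h0, ← h1, (key (Fin.last m)).2, h0, h1, γ.closed, sub_self]

theorem ClosedPath.integral_add {f g : ℂ → ℂ} (hf : ContinuousOn f γ.trace)
    (hg : ContinuousOn g γ.trace) : γ.integral (f + g) = γ.integral f + γ.integral g := by
  rw [ClosedPath.integral, ClosedPath.integral, ClosedPath.integral,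
    ← intervalIntegral.integral_add (γ.intervalIntegrable hf) (γ.intervalIntegrable hg)]
  simp only [Pi.add_apply, mul_add]

theorem ClosedPath.integral_smul (c : ℂ) (f : ℂ → ℂ) : γ.integral (c • f) = c * γ.integral f := by
  rw [ClosedPath.integral, ClosedPath.integral, ← intervalIntegral.integral_const_mul]
  simp only [Pi.smul_apply, smul_eq_mul, mul_left_comm]

theorem ClosedPath.integral_congr {f g : ℂ → ℂ} (h : Set.EqOn f g γ.trace) :
    γ.integral f = γ.integral g := by
  refine intervalIntegral.integral_congr fun s hs => ?_
  rw [Set.uIcc_of_le γ.a_lt_b.le] at hs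
  simp only [h ⟨s, hs, rfl⟩]

theorem circlePath_integral (R : ℝ) (f : ℂ → ℂ) : (circlePath R).integral f = ∮ x in C(0, R), f x :=
  rfl

theorem cycleIntegral_toCycle (f : ℂ → ℂ) : cycleIntegral γ.toCycle f = γ.integral f := by
  simp [cycleIntegral, ClosedPath.toCycle]

theorem cycleIntegral_sum {ι : Type*} (s : Finset ι) (Γ : ι → Cycle1) (f : ℂ → ℂ) :
    cycleIntegral (∑ i ∈ s, Γ i) f = ∑ i ∈ s, cycleIntegral (Γ i) f :=
  (Finsupp.sum_finsetSum_index (by simp) fun _ _ _ => by push_cast; ring).symm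

theorem windingNumber_sum {ι : Type*} (s : Finset ι) (Γ : ι → Cycle1) (p : ℂ) :
    windingNumber (∑ i ∈ s, Γ i) p = ∑ i ∈ s, windingNumber (Γ i) p := by
  simp only [windingNumber, cycleIntegral_sum, Finset.mul_sum]

theorem windingNumber_circlePath {R : ℝ} {p : ℂ} (hp : ‖p‖ < R) :
    windingNumber (circlePath R).toCycle p = 1 := by
  rw [windingNumber, cycleIntegral_toCycle, circlePath_integral,
    circleIntegral.integral_sub_inv_of_mem_ball (by simpa using hp)]
  exact inv_mul_cancel₀ Complex.two_pi_I_ne_zero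

theorem ClosedPath.liesIn_toCycle {U : Set ℂ} (h : γ.trace ⊆ U) : γ.toCycle.LiesIn U := by
  intro γ' hγ'
  have := Finsupp.support_single_subset hγ'
  rw [Finset.mem_singleton] at this
  rwa [this]

theorem Cycle1.LiesIn.sum {ι : Type*} {s : Finset ι} {Γ : ι → Cycle1} {U : Set ℂ}
    (h : ∀ i ∈ s, (Γ i).LiesIn U) : Cycle1.LiesIn (∑ i ∈ s, Γ i) U := by
  classical
  intro γ hγ
  obtain ⟨i, hi, hγi⟩ := Finset.mem_biUnion.1 (Finsupp.support_finsetSum hγ)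
  exact h i hi γ hγi

theorem circlePath_trace (R : ℝ) (hR : 0 < R) : (circlePath R).trace ⊆ Metric.sphere 0 R := by
  rintro _ ⟨s, -, rfl⟩
  exact circleMap_mem_sphere 0 hR.le s

end Paths

/-! ### Partial fractions and homology invariance -/

section PartialFractions

/-- The elementary fractions with poles in `S`. -/
def elementaryFractions (S : Set ℂ) : Set (ℂ → ℂ) :=
  {f | (∃ m : ℕ, f = fun x => x ^ m) ∨ ∃ p ∈ S, ∃ m : ℕ, f = fun x => (x - p)⁻¹ ^ (m + 1)}

variable {S : Set ℂ}

/-- Powers of x reduce by x^{m+1}/(x - a) = x^m + a x^m/(x - a). For p ≠ a the product 1/((x - p)(x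
- a)) splits into a difference of simple fractions, lowering the order at p; for p = a the order
just rises. -/
theorem exists_span_mul_inv {a : ℂ} (ha : a ∈ S) {g : ℂ → ℂ}
    (hg : g ∈ Submodule.span ℂ (elementaryFractions S)) :
    ∃ g' ∈ Submodule.span ℂ (elementaryFractions S), ∀ x, x ∉ S → g x * (x - a)⁻¹ = g' x := by
  have hsub : ∀ x, x ∉ S → ∀ p ∈ S, x - p ≠ 0 := fun x hx p hp h => hx (by rwa [sub_eq_zero.1 h])
  have hfrac : ∀ p ∈ S, ∀ m : ℕ, (fun x => (x - p)⁻¹ ^ (m + 1)) ∈ Submodule.span ℂ (elementaryFractions S) :=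
    fun p hp m => Submodule.subset_span (Or.inr ⟨p, hp, m, rfl⟩)
  induction hg using Submodule.span_induction with
  | mem f hf =>
    rcases hf with ⟨m, rfl⟩ | ⟨p, hp, m, rfl⟩
    · induction m with
      | zero => exact ⟨_, hfrac a ha 0, fun x _ => by simp⟩
      | succ m ih =>
        obtain ⟨g', hg', h⟩ := ih
        refine ⟨(fun x => x ^ m) + a • g',
          add_mem (Submodule.subset_span (Or.inl ⟨m, rfl⟩)) (Submodule.smul_mem _ _ hg'), ?_⟩
        intro x hx
        have := hsub x hx a ha
        simp only [Pi.add_apply, Pi.smul_apply, smul_eq_mul, ← h x hx]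
        field_simp
        ring
    · by_cases hpa : p = a
      · subst hpa
        exact ⟨_, hfrac p hp (m + 1), fun x _ => (pow_succ _ _).symm⟩
      · have hpa' : a - p ≠ 0 := sub_ne_zero.2 (Ne.symm hpa)
        have key : ∀ m : ℕ, ∃ g' ∈ Submodule.span ℂ (elementaryFractions S),
            ∀ x, x ∉ S → (x - p)⁻¹ ^ m * (x - a)⁻¹ = g' x := by
          intro m
          induction m with
          | zero => exact ⟨_, hfrac a ha 0, fun x _ => by simp⟩
          | succ m ih =>
            obtain ⟨g', hg', h⟩ := ih
            refine ⟨(a - p)⁻¹ • (g' - fun x => (x - p)⁻¹ ^ (m + 1)),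
              Submodule.smul_mem _ _ (sub_mem hg' (hfrac p hp m)), ?_⟩
            intro x hx
            have h1 := hsub x hx a ha
            have h2 := hsub x hx p hp
            simp only [Pi.sub_apply, Pi.smul_apply, smul_eq_mul, ← h x hx]
            have : (x - p)⁻¹ * (x - a)⁻¹ = (a - p)⁻¹ * ((x - a)⁻¹ - (x - p)⁻¹) := by
              field_simp
              ring
            linear_combination (x - p)⁻¹ ^ m * this
        exact key (m + 1)
  | zero => exact ⟨0, zero_mem _, fun x _ => by simp⟩
  | add f g _ _ hf hg =>
    obtain ⟨f', hf', h1⟩ := hf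
    obtain ⟨g', hg', h2⟩ := hg
    exact ⟨f' + g', add_mem hf' hg', fun x hx => by
      rw [Pi.add_apply, Pi.add_apply, add_mul, h1 x hx, h2 x hx]⟩
  | smul c f _ hf =>
    obtain ⟨f', hf', h1⟩ := hf
    exact ⟨c • f', Submodule.smul_mem _ _ hf', fun x hx => by
      rw [Pi.smul_apply, Pi.smul_apply, smul_eq_mul, smul_eq_mul, mul_assoc, h1 x hx]⟩

/-- Partial fraction decomposition. -/
theorem exists_span_eq_pow_mul_prod {ι : Type*} (s : Finset ι) (p : ι → ℂ) (hp : ∀ i ∈ s, p i ∈ S)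
    (m : ℕ) : ∃ g ∈ Submodule.span ℂ (elementaryFractions S),
      ∀ x, x ∉ S → x ^ m * ∏ i ∈ s, (x - p i)⁻¹ = g x := by
  classical
  induction s using Finset.induction_on with
  | empty => exact ⟨_, Submodule.subset_span (Or.inl ⟨m, rfl⟩), fun x _ => by simp⟩
  | insert i s hi ih =>
    obtain ⟨g, hg, h⟩ := ih fun j hj => hp j (Finset.mem_insert_of_mem hj)
    obtain ⟨g', hg', h'⟩ := exists_span_mul_inv (hp i (Finset.mem_insert_self _ _)) hg
    refine ⟨g', hg', fun x hx => ?_⟩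
    rw [← h' x hx, ← h x hx, Finset.prod_insert hi]
    ring

theorem continuousOn_of_mem_span {g : ℂ → ℂ}
    (hg : g ∈ Submodule.span ℂ (elementaryFractions S)) : ContinuousOn g Sᶜ := by
  induction hg using Submodule.span_induction with
  | mem f hf =>
    rcases hf with ⟨m, rfl⟩ | ⟨p, hp, m, rfl⟩
    · exact (continuous_pow m).continuousOn
    · have h0 : ∀ x ∈ Sᶜ, x - p ≠ 0 := fun x hx h => hx (by rwa [sub_eq_zero.1 h])
      exact ((continuousOn_id.sub continuousOn_const).inv₀ h0).pow _
  | zero => exact continuousOn_const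
  | add f g _ _ hf hg => exact hf.add hg
  | smul c f _ hf => exact continuousOn_const.smul hf

theorem cycleIntegral_add {Γ : Cycle1} {U : Set ℂ} (hΓ : Γ.LiesIn U) {f g : ℂ → ℂ}
    (hf : ContinuousOn f U) (hg : ContinuousOn g U) :
    cycleIntegral Γ (f + g) = cycleIntegral Γ f + cycleIntegral Γ g := by
  rw [cycleIntegral, cycleIntegral, cycleIntegral, Finsupp.sum, Finsupp.sum, Finsupp.sum,
    ← Finset.sum_add_distrib]
  refine Finset.sum_congr rfl fun γ hγ => ?_
  rw [γ.integral_add (hf.mono (hΓ γ hγ)) (hg.mono (hΓ γ hγ)), mul_add]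

theorem cycleIntegral_smul (Γ : Cycle1) (c : ℂ) (f : ℂ → ℂ) :
    cycleIntegral Γ (c • f) = c * cycleIntegral Γ f := by
  rw [cycleIntegral, cycleIntegral, Finsupp.sum, Finsupp.sum, Finset.mul_sum]
  refine Finset.sum_congr rfl fun γ _ => ?_
  rw [γ.integral_smul]
  ring

theorem cycleIntegral_congr {Γ : Cycle1} {U : Set ℂ} (hΓ : Γ.LiesIn U) {f g : ℂ → ℂ}
    (h : Set.EqOn f g U) : cycleIntegral Γ f = cycleIntegral Γ g :=
  Finset.sum_congr rfl fun γ hγ => by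
    simp only [γ.integral_congr (h.mono (hΓ γ hγ))]

theorem cycleIntegral_eq_zero {Γ : Cycle1} {U : Set ℂ} (hΓ : Γ.LiesIn U) {f F : ℂ → ℂ}
    (hf : ContinuousOn f U) (hF : ∀ x ∈ U, HasDerivAt F (f x) x) : cycleIntegral Γ f = 0 :=
  Finset.sum_eq_zero fun γ hγ => by
    simp only [γ.integral_eq_zero (hf.mono (hΓ γ hγ)) fun x hx => hF x (hΓ γ hγ hx), mul_zero]

/-- Cauchy's theorem for elementary fractions over homologous cycles. -/
theorem Homologous.cycleIntegral_eq {Γ Γ' : Cycle1} (h : Homologous Sᶜ Γ Γ') {g : ℂ → ℂ}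
    (hg : g ∈ Submodule.span ℂ (elementaryFractions S)) : cycleIntegral Γ g = cycleIntegral Γ' g := by
  obtain ⟨hΓ, hΓ', hw⟩ := h
  induction hg using Submodule.span_induction with
  | mem f hf =>
    have hcont := continuousOn_of_mem_span (Submodule.subset_span hf)
    rcases hf with ⟨m, rfl⟩ | ⟨p, hp, m, rfl⟩
    · have hF : ∀ x ∈ Sᶜ, HasDerivAt (fun x : ℂ => x ^ (m + 1) / ((m + 1 : ℕ) : ℂ)) (x ^ m) x := by
        intro x _
        have := (hasDerivAt_pow (m + 1) x).div_const ((m + 1 : ℕ) : ℂ)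
        rwa [Nat.add_sub_cancel, mul_div_cancel_left₀ _ (Nat.cast_ne_zero.2 m.succ_ne_zero)] at this
      rw [cycleIntegral_eq_zero hΓ hcont hF, cycleIntegral_eq_zero hΓ' hcont hF]
    -- Only the simple fraction lacks a primitive; its integral is 2πi times the winding number
    -- around p.
    · rcases Nat.eq_zero_or_pos m with rfl | hm
      · have := hw p (by simpa using hp)
        simp only [zero_add, pow_one]
        exact mul_left_cancel₀ (inv_ne_zero Complex.two_pi_I_ne_zero) this
      · have hF : ∀ x ∈ Sᶜ, HasDerivAt (fun x : ℂ => -(x - p)⁻¹ ^ m / (m : ℂ))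
            ((x - p)⁻¹ ^ (m + 1)) x := by
          intro x hx
          have h0 : x - p ≠ 0 := fun h => hx (by rwa [show x = p from sub_eq_zero.1 h])
          have := ((((hasDerivAt_id x).sub_const p).inv h0).pow m).neg.div_const (m : ℂ)
          refine this.congr_deriv ?_
          have hm' : (m : ℂ) ≠ 0 := Nat.cast_ne_zero.2 hm.ne'
          obtain ⟨l, rfl⟩ : ∃ l, m = l + 1 := ⟨m - 1, by omega⟩
          simp only [id, Pi.inv_apply, Nat.add_sub_cancel, inv_pow]
          field_simp
          ring
        rw [cycleIntegral_eq_zero hΓ hcont hF, cycleIntegral_eq_zero hΓ' hcont hF]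
  | zero => simp [cycleIntegral, ClosedPath.integral]
  | add f g hf hg h1 h2 =>
    rw [cycleIntegral_add hΓ (continuousOn_of_mem_span hf) (continuousOn_of_mem_span hg),
      cycleIntegral_add hΓ' (continuousOn_of_mem_span hf) (continuousOn_of_mem_span hg), h1, h2]
  | smul c f _ h1 => rw [cycleIntegral_smul, cycleIntegral_smul, h1]

end PartialFractions

/-! ### Φ over homologous cycles, and assembly -/

section Main

variable {n : ℕ}

theorem Homologous.cycleIntegral_phi_eq {q : ℝ} {k lam : ℕ} {y : Fin (n + 1) → ℂ} (hk : 1 ≤ k)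
    {Γ Γ' : Cycle1} (h : Homologous (poles q k y)ᶜ Γ Γ') :
    cycleIntegral Γ (phi q k lam y) = cycleIntegral Γ' (phi q k lam y) := by
  set T := (Finset.univ : Finset (Fin (n + 1) × ℤˣ)) ×ˢ Finset.range k with hT
  -- With N factors, Φ is x^{lam+N-1} ∏ (x - p)⁻¹ away from 0. The bound makes this exponent
  -- positive, so at x = 0 it vanishes, matching the default value of division by zero in `phi`.
  have hcard : 2 ≤ T.card := by
    rw [hT, Finset.card_product, Finset.card_univ, Fintype.card_prod, Fintype.card_fin,
      Finset.card_range]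
    have : Fintype.card ℤˣ = 2 := rfl
    rw [this]
    nlinarith [Nat.zero_le n]
  obtain ⟨g, hg, hgx⟩ := exists_span_eq_pow_mul_prod (S := poles q k y) T
    (fun p => pole q y p.1.1 p.1.2 p.2) (fun p hp =>
      ⟨p.1.1, p.1.2, p.2, Finset.mem_range.1 (Finset.mem_product.1 hp).2, rfl⟩) (lam + T.card - 1)
  have heq : Set.EqOn (phi q k lam y) g (poles q k y)ᶜ := by
    intro x hx
    rw [← hgx x hx, phi_eq_prod_poles, ← hT]
    by_cases hx0 : x = 0
    · rw [hx0, div_zero, zero_pow (by omega), zero_mul]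
    · have : ∀ p : (Fin (n + 1) × ℤˣ) × ℕ, (1 - pole q y p.1.1 p.1.2 p.2 / x)⁻¹ =
          x * (x - pole q y p.1.1 p.1.2 p.2)⁻¹ := by
        intro p
        rw [one_sub_div hx0, inv_div, div_eq_mul_inv]
      rw [Finset.prod_congr rfl fun p _ => this p, Finset.prod_mul_distrib, Finset.prod_const,
        ← mul_assoc, ← pow_add, mul_div_right_comm]
      congr 1
      rw [div_eq_iff hx0, ← pow_succ]
      congr 1
      omega
  rw [cycleIntegral_congr h.1 heq, cycleIntegral_congr h.2.1 heq, h.cycleIntegral_eq hg]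

theorem homologous_circlePath_sum {q : ℝ} {k : ℕ} {y : Fin n → ℂ} {R : ℝ} (hR : 0 < R)
    (hp : ∀ p ∈ poles q k y, ‖p‖ < R) (c : Fin n → ℤˣ → ClosedPath)
    (hc : ∀ i s, IsolatesFamily q k y i s (c i s)) :
    Homologous (poles q k y)ᶜ (circlePath R).toCycle (∑ i, ∑ s : ℤˣ, (c i s).toCycle) := by
  refine ⟨ClosedPath.liesIn_toCycle _ fun x hx hx' => ?_, Cycle1.LiesIn.sum fun i _ =>
    Cycle1.LiesIn.sum fun s _ => ClosedPath.liesIn_toCycle _ (hc i s).1, fun p hp' => ?_⟩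
  · have := circlePath_trace R hR hx
    rw [mem_sphere_zero_iff_norm] at this
    exact (hp x hx').ne this
  · rw [Set.mem_compl_iff, not_not] at hp'
    rw [windingNumber_circlePath (hp p hp')]
    obtain ⟨i, s, l, hl, rfl⟩ := hp'
    simp only [windingNumber_sum]
    rw [Finset.sum_eq_single i, Finset.sum_eq_single s]
    · rw [(hc i s).2 i s l hl, if_pos ⟨rfl, rfl⟩]
    · intro r _ hr
      rw [(hc i r).2 i s l hl, if_neg fun h => hr h.2.symm]
    · exact fun h => absurd (Finset.mem_univ _) h
    · intro j _ hj
      refine Finset.sum_eq_zero fun r _ => ?_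
      rw [(hc j r).2 i s l hl, if_neg fun h => hj h.1.symm]
    · exact fun h => absurd (Finset.mem_univ _) h

theorem rescale_qBinomSeries_prod_mul_poles {q : ℝ} (hq : ∀ m : ℕ, (q : ℂ) ^ (m + 1) ≠ 1) (k : ℕ)
    (y : Fin n → ℂ) :
    (∏ i, ∏ s : ℤˣ, PowerSeries.rescale (y i ^ (s : ℤ)) (qBinomSeries q k)) *
      ∏ p ∈ (Finset.univ : Finset (Fin n × ℤˣ)) ×ˢ Finset.range k,
        (1 - PowerSeries.C (pole q y p.1.1 p.1.2 p.2) * PowerSeries.X) = 1 := by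
  rw [Finset.prod_product, ← Fintype.prod_prod_type
    (f := fun p : Fin n × ℤˣ => PowerSeries.rescale (y p.1 ^ (p.2 : ℤ)) (qBinomSeries q k)),
    ← Finset.prod_mul_distrib]
  exact Finset.prod_eq_one fun p _ => rescale_qBinomSeries_mul_prod hq k _

end Main

end

theorem theorem2 (n : ℕ) (hn : 1 ≤ n) (q : ℝ) (hq0 : 0 < q) (hq1 : q < 1)
    (k : ℕ) (hk : 1 ≤ k) (t : ℝ) (ht : t = q ^ k) (lam : ℕ) :
    ∃ P : Laurent n,
      -- `P` is the Macdonald polynomial, which exists and is unique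
      IsMacdonald q t (rowPartition n lam) P ∧
      (∀ P' : Laurent n, IsMacdonald q t (rowPartition n lam) P' → P' = P) ∧
      ∀ y : Fin n → ℂ, (∀ i, y i ≠ 0) →
        ∀ R : ℝ, (∀ p ∈ poles q k y, ‖p‖ < R) →
          -- the integral over the circle `C` of radius `R`
          (2 * π * Complex.I)⁻¹ * (∮ x in C(0, R), phi q k lam y x)
            = qPoch t q lam / qPoch q q lam * P.eval y ∧
          -- the same for every cycle homologous to `C` in the complement of the poles
          (∀ Γ : Cycle1, Homologous (poles q k y)ᶜ Γ (circlePath R).toCycle →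
            (2 * π * Complex.I)⁻¹ * cycleIntegral Γ (phi q k lam y)
              = qPoch t q lam / qPoch q q lam * P.eval y) ∧
          -- `C` is homologous to the sum of the cycles `C_i^(±)`
          (∀ c : Fin n → ℤˣ → ClosedPath, (∀ i s, IsolatesFamily q k y i s (c i s)) →
            Homologous (poles q k y)ᶜ (circlePath R).toCycle
              (∑ i, ∑ s : ℤˣ, (c i s).toCycle)) := by
  obtain ⟨n, rfl⟩ : ∃ m, n = m + 1 := ⟨n - 1, by omega⟩
  subst ht
  have hq : ∀ m : ℕ, (q : ℂ) ^ (m + 1) ≠ 1 := by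
    intro m
    exact_mod_cast (pow_lt_one₀ hq0.le hq1 m.succ_ne_zero).ne
  have hcoeff : qPoch ((q ^ k : ℝ) : ℂ) q lam / qPoch q q lam =
      PowerSeries.coeff lam (qBinomSeries q k) := by
    rw [qBinomSeries, PowerSeries.coeff_mk, Complex.ofReal_pow]
  -- The factors of the numerator are 1 - q^{k+i}, nonzero because k ≥ 1.
  have hne : PowerSeries.coeff lam (qBinomSeries (q : ℂ) k) ≠ 0 := by
    rw [← hcoeff]
    refine div_ne_zero (Finset.prod_ne_zero_iff.2 fun i _ => ?_) (qPoch_self_ne_zero hq lam)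
    obtain ⟨l, rfl⟩ : ∃ l, k = l + 1 := ⟨k - 1, by omega⟩
    have := hq (l + i)
    rw [Complex.ofReal_pow, ← pow_add, add_right_comm]
    exact sub_ne_zero.2 this.symm
  have hP := isMacdonald_rowLaurent (n := n) hq0 hq1 hk lam hne
  refine ⟨_, hP, fun P' hP' => hP.unique_of_row hq0 hq1 (pow_pos hq0 k)
    (pow_lt_one₀ hq0.le hq1 (by omega)) hP', fun y hy R hR => ?_⟩
  -- The radius is positive because at least one pole, y_1 itself, lies inside the circle.
  have hR0 : 0 < R := (norm_nonneg _).trans_lt (hR _ ⟨0, 1, 0, by omega, rfl⟩)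
  have hmain : (2 * π * Complex.I)⁻¹ * (∮ x in C(0, R), phi q k lam y x) =
      qPoch ((q ^ k : ℝ) : ℂ) q lam / qPoch q q lam *
        ((PowerSeries.coeff lam (qBinomSeries (q : ℂ) k))⁻¹ • rowLaurent (n + 1) q k lam).eval y := by
    rw [Laurent.eval_smul _ _ _ hy, hcoeff, mul_inv_cancel_left₀ hne, eval_rowLaurent _ _ _ _ hy]
    exact circleIntegral_phi q k lam y hR0 hR _ (rescale_qBinomSeries_prod_mul_poles hq k y)
  refine ⟨hmain, fun Γ hΓ => ?_, homologous_circlePath_sum hR0 hR⟩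
  rw [hΓ.cycleIntegral_phi_eq hk, cycleIntegral_toCycle, circlePath_integral, hmain]
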